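/- Let $\mathbb{D}$ be the open unit disc and $p\in(\sqrt3-1,1)$. Let $Co(p)$ be the class of functions $f:\mathbb{D}\to\overline{\mathbb{C}}$ such that (i) $f$ is meromorphic in $\mathbb{D}$ with a simple pole at $p$; (ii) $f(0)=f'(0)-1=0$; (iii) $f$ maps $\mathbb{D}$ conformally (i.e. injectively) onto a set whose complement with respect to $\overline{\mathbb{C}}$ is convex. Then the closed convex hull of $Co(p)$, in the topology of uniform convergence on compact subsets (functions with their only pole at $p$ being regarded as holomorphic functions on $\mathbb{D}\setminus\{p\}$), is a proper subset of the class of all functions $$ f(z)=\frac{z-\frac{p}{1+p^2}(1+\omega(z))z^2}{\left(1-\frac zp\right)(1-zp)}, $$ where $\omega:\mathbb{D}\to\overline{\mathbb{D}}$ is holomorphic. -/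

import Mathlib

noncomputable section

namespace ConcaveUnivalent

/-- The open unit disc with the point `p` removed. -/
def puncturedDisc (p : ℝ) : Set ℂ := Metric.ball (0 : ℂ) 1 \ {(p : ℂ)}

/-- The map into the Riemann sphere which has the value `∞` at `p` and agrees with `F`
at all other points. -/
def toSphere (p : ℝ) (F : ℂ → ℂ) (z : ℂ) : OnePoint ℂ :=
  open Classical in if z = (p : ℂ) then OnePoint.infty else (F z : OnePoint ℂ)

/-- `F`, regarded as a map of the open unit disc into the Riemann sphere with value `∞` at `p`,
is a concave univalent function with pole `p`, normalised at the origin. Only the values of `F`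
in the punctured disc matter. A univalent meromorphic function with a pole at `p` has no other
pole, so it is holomorphic in the punctured disc. -/
structure IsConcave (p : ℝ) (F : ℂ → ℂ) : Prop where
  /-- `F` is holomorphic in the disc, apart from `p`. -/
  holomorphic : DifferentiableOn ℂ F (puncturedDisc p)
  /-- `F` has a simple pole at `p`. -/
  simple_pole : meromorphicOrderAt F (p : ℂ) = -1
  map_zero : F 0 = 0
  deriv_zero : deriv F 0 = 1
  /-- The map of the disc into the sphere is injective. -/
  injective : Set.InjOn (toSphere p F) (Metric.ball 0 1)
  /-- The complement of the image in the sphere is convex. It does not contain `∞`, the value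
  at `p`, so it is a set of complex numbers. -/
  convex_compl : Convex ℝ {w : ℂ | (w : OnePoint ℂ) ∈ (toSphere p F '' Metric.ball 0 1)ᶜ}

/-- The class `Co(p)`. A function with its only pole at `p` is identified with its restriction
to the punctured disc, an element of the real vector space `C(puncturedDisc p, ℂ)`, whose
(compact-open) topology is that of uniform convergence on compact subsets. -/
def Co (p : ℝ) : Set C(puncturedDisc p, ℂ) :=
  {f | ∃ F : ℂ → ℂ, IsConcave p F ∧ ∀ z : puncturedDisc p, f z = F z}

/-- The class of functions
`z ↦ (z - p / (1 + p ^ 2) * (1 + ω z) * z ^ 2) / ((1 - z / p) * (1 - z * p))`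
with `ω` holomorphic from the open unit disc to the closed unit disc. -/
def representedClass (p : ℝ) : Set C(puncturedDisc p, ℂ) :=
  {f | ∃ ω : ℂ → ℂ, DifferentiableOn ℂ ω (Metric.ball 0 1) ∧
    Set.MapsTo ω (Metric.ball 0 1) (Metric.closedBall 0 1) ∧
    ∀ z : puncturedDisc p,
      f z = ((z : ℂ) - (p : ℂ) / (1 + (p : ℂ) ^ 2) * (1 + ω z) * (z : ℂ) ^ 2) /
        ((1 - (z : ℂ) / (p : ℂ)) * (1 - (z : ℂ) * (p : ℂ)))}

end ConcaveUnivalent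

end

noncomputable section

open Set Filter Metric Topology Function

namespace ConcaveUnivalent

/-! ### Univalent functions and their inverses -/

section Univalent

variable {U : Set ℂ} {g : ℂ → ℂ} {z : ℂ}

/-! A continuous real-linear functional separates the hull from one represented function:
`laurentCoeff`, the coefficient of `z - p` in the Laurent expansion at `p`. On `Co p` its modulus is
at most `p² / (1 - p²)³` (`norm_laurentCoeff_le`), so on the closed convex hull its real part is at
least the negative of that bound. For the represented function with `ω z = -z` it is real and falls
below this as soon as `p > 1/2` (`laurentCoeff_counterexample_lt`). Since the represented class is
convex and closed, the inclusion has to be proved only for `Co p` itself.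

Inclusion and bound both rest on a two-point inequality. Composing with the involution of the disc
that exchanges `0` and `p` moves the pole to `0`; write the new function as `g z = G z / z`. A
maximum principle shows that a convex combination of two values of `g` on `‖z‖ = r` is not attained
inside that circle (`le_norm_of_combination`). Differentiating along the segment gives `0 ≤ Re ((g ζ
- g z) / (z g'(z)))` for `‖z‖ = ‖ζ‖ = r`. Twice the reciprocal plus `(z + ζ) / (z - ζ)`, which is
imaginary there, has no singularity on the diagonal, so the minimum principle in each variable makes
it a Carathéodory function on the bidisc. Schwarz's lemma in `z` and then in `ζ` yields
`norm_kernelSlope_le`.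

With `z = p`, where the normalisation of `F` at the origin fixes `G` and `g'`, the inequality is the
representation formula. With `ζ = 0` and `z → 0` it bounds the coefficient of `z` in `g` by the
residue, which the representation bounds in turn. -/

theorem eventually_invFunOn_eq (hU : IsOpen U) (hinj : InjOn g U) (hz : z ∈ U) :
    ∀ᶠ y in 𝓝 z, invFunOn g U (g y) = y := by
  filter_upwards [hU.mem_nhds hz] with y hy using hinj.leftInvOn_invFunOn hy

theorem nhds_le_map_of_injOn (hU : IsOpen U) (hg : DifferentiableOn ℂ g U) (hinj : InjOn g U)
    (hz : z ∈ U) : 𝓝 (g z) ≤ map g (𝓝 z) := by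
  refine (hg.analyticAt (hU.mem_nhds hz)).eventually_constant_or_nhds_le_map_nhds.resolve_left ?_
  intro h
  have h1 : ∀ᶠ y in 𝓝 z, y = z := by
    filter_upwards [h, hU.mem_nhds hz] with y hy hyU using hinj hyU hz hy
  have h2 : ∀ᶠ y in 𝓝[≠] z, y = z := h1.filter_mono nhdsWithin_le_nhds
  obtain ⟨y, hy, hy'⟩ := (h2.and self_mem_nhdsWithin).exists
  exact hy' hy

theorem isOpen_image_of_injOn (hU : IsOpen U) (hg : DifferentiableOn ℂ g U) (hinj : InjOn g U) :
    IsOpen (g '' U) := by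
  rw [isOpen_iff_mem_nhds]
  rintro _ ⟨z, hz, rfl⟩
  exact nhds_le_map_of_injOn hU hg hinj hz (image_mem_map (hU.mem_nhds hz))

theorem continuousAt_invFunOn (hU : IsOpen U) (hg : DifferentiableOn ℂ g U) (hinj : InjOn g U)
    (hz : z ∈ U) : ContinuousAt (invFunOn g U) (g z) := by
  have h : Tendsto (invFunOn g U) (map g (𝓝 z)) (𝓝 z) := by
    rw [tendsto_map'_iff]
    exact tendsto_id.congr' ((eventually_invFunOn_eq hU hinj hz).mono fun y hy => hy.symm)
  rw [ContinuousAt, hinj.leftInvOn_invFunOn hz]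
  exact h.mono_left (nhds_le_map_of_injOn hU hg hinj hz)

theorem eventually_apply_invFunOn (hU : IsOpen U) (hg : DifferentiableOn ℂ g U)
    (hinj : InjOn g U) (hz : z ∈ U) : ∀ᶠ w in 𝓝 (g z), g (invFunOn g U w) = w := by
  filter_upwards [(isOpen_image_of_injOn hU hg hinj).mem_nhds (mem_image_of_mem g hz)] with w hw
  exact invFunOn_eq hw

theorem hasDerivAt_invFunOn_of_deriv_ne_zero (hU : IsOpen U) (hg : DifferentiableOn ℂ g U)
    (hinj : InjOn g U) (hz : z ∈ U) (hz' : deriv g z ≠ 0) :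
    HasDerivAt (invFunOn g U) (deriv g z)⁻¹ (g z) := by
  refine HasDerivAt.of_local_left_inverse (continuousAt_invFunOn hU hg hinj hz) ?_ hz'
    (eventually_apply_invFunOn hU hg hinj hz)
  rw [hinj.leftInvOn_invFunOn hz]
  exact (hg.differentiableAt (hU.mem_nhds hz)).hasDerivAt

/-- Zeros of `deriv g` are isolated, since otherwise `g` would be constant on a ball. Hence the
inverse is holomorphic off `g z` and continuous there, so the singularity is removable, and the
chain rule at a zero of the derivative would give `0 = 1`. -/
theorem deriv_ne_zero_of_injOn (hU : IsOpen U) (hg : DifferentiableOn ℂ g U) (hinj : InjOn g U)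
    (hz : z ∈ U) : deriv g z ≠ 0 := by
  intro h0
  have hne : ∀ᶠ y in 𝓝[≠] z, deriv g y ≠ 0 := by
    have han : AnalyticAt ℂ (deriv g) z := (hg.analyticAt (hU.mem_nhds hz)).deriv
    refine han.eventually_eq_zero_or_eventually_ne_zero.resolve_left fun hev => ?_
    obtain ⟨ε, hε, hball⟩ := Metric.eventually_nhds_iff_ball.1 (hev.and (hU.mem_nhds hz))
    have hy : z + (ε / 2 : ℝ) ∈ ball z ε := by
      simpa [abs_of_pos hε] using hε
    have hconst : g (z + (ε / 2 : ℝ)) = g z :=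
      (convex_ball z ε).is_const_of_fderivWithin_eq_zero (𝕜 := ℂ)
        (hg.mono fun y hy => (hball y hy).2) (fun y hy => by
          rw [fderivWithin_of_isOpen isOpen_ball hy]
          ext
          simpa using (hball y hy).1) hy (mem_ball_self hε)
    have := hinj (hball _ hy).2 hz hconst
    simp [hε.ne'] at this
  have hnhds : g '' U ∈ 𝓝 (g z) :=
    (isOpen_image_of_injOn hU hg hinj).mem_nhds (mem_image_of_mem g hz)
  obtain ⟨s, hs, hsne⟩ : ∃ s ∈ 𝓝 z, ∀ y ∈ s, y ≠ z → deriv g y ≠ 0 :=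
    ⟨_, eventually_nhdsWithin_iff.1 hne, fun y hy => hy⟩
  have hs' : g '' (s ∩ U) ∈ 𝓝 (g z) :=
    nhds_le_map_of_injOn hU hg hinj hz (image_mem_map (inter_mem hs (hU.mem_nhds hz)))
  have hdiff : DifferentiableOn ℂ (invFunOn g U) (g '' (s ∩ U)) := by
    refine (Complex.differentiableOn_compl_singleton_and_continuousAt_iff hs').1
      ⟨?_, continuousAt_invFunOn hU hg hinj hz⟩
    rintro _ ⟨⟨y, hy, rfl⟩, hyz⟩
    have : y ≠ z := fun h => hyz (by rw [h]; rfl)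
    exact (hasDerivAt_invFunOn_of_deriv_ne_zero hU hg hinj hy.2
      (hsne y hy.1 this)).differentiableAt.differentiableWithinAt
  have h1 := (hdiff.differentiableAt hs').hasDerivAt.comp z
    (hg.differentiableAt (hU.mem_nhds hz)).hasDerivAt
  have h2 : HasDerivAt (invFunOn g U ∘ g) 1 z :=
    (hasDerivAt_id z).congr_of_eventuallyEq (eventually_invFunOn_eq hU hinj hz)
  have := h1.unique h2
  simp [h0] at this

theorem hasDerivAt_invFunOn (hU : IsOpen U) (hg : DifferentiableOn ℂ g U)
    (hinj : InjOn g U) (hz : z ∈ U) : HasDerivAt (invFunOn g U) (deriv g z)⁻¹ (g z) :=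
  hasDerivAt_invFunOn_of_deriv_ne_zero hU hg hinj hz (deriv_ne_zero_of_injOn hU hg hinj hz)

end Univalent

/-! ### Concave functions with pole at the origin -/

/-- The function `z ↦ G z / z` is a concave univalent function in the unit disc with a simple
pole at the origin. -/
structure IsPolarConcave (G : ℂ → ℂ) : Prop where
  holomorphic : DifferentiableOn ℂ G (ball 0 1)
  ne_zero : G 0 ≠ 0
  injective : InjOn (fun z => G z / z) (ball 0 1 \ {0})
  convex_compl : Convex ℝ ((fun z => G z / z) '' (ball 0 1 \ {0}))ᶜ

namespace IsPolarConcave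

variable {G : ℂ → ℂ} {z z₁ z₂ w x : ℂ} {r s t : ℝ}

theorem isOpen_puncturedBall : IsOpen (ball (0 : ℂ) s \ {0}) := isOpen_ball.sdiff isClosed_singleton

theorem mem_puncturedBall : z ∈ ball (0 : ℂ) s \ {0} ↔ ‖z‖ < s ∧ z ≠ 0 := by simp

theorem differentiableOn_div (h : IsPolarConcave G) :
    DifferentiableOn ℂ (fun z => G z / z) (ball 0 1 \ {0}) :=
  (h.holomorphic.mono sdiff_subset).div differentiableOn_id fun _ hz => hz.2

theorem differentiableAt_div (h : IsPolarConcave G) (hz : ‖z‖ < 1) (hz0 : z ≠ 0) :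
    DifferentiableAt ℂ (fun z => G z / z) z :=
  h.differentiableOn_div.differentiableAt
    (isOpen_puncturedBall.mem_nhds (mem_puncturedBall.2 ⟨hz, hz0⟩))

theorem continuousAt (h : IsPolarConcave G) (hz : ‖z‖ < 1) : ContinuousAt G z :=
  (h.holomorphic.differentiableAt (isOpen_ball.mem_nhds (by simpa using hz))).continuousAt

/-- The inverse function of `z ↦ G z / z`. -/
def inv (G : ℂ → ℂ) : ℂ → ℂ := invFunOn (fun z => G z / z) (ball 0 1 \ {0})

theorem inv_apply (h : IsPolarConcave G) (hz : ‖z‖ < 1) (hz0 : z ≠ 0) : inv G (G z / z) = z :=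
  h.injective.leftInvOn_invFunOn (mem_puncturedBall.2 ⟨hz, hz0⟩)

theorem hasDerivAt_inv (h : IsPolarConcave G) (hz : ‖z‖ < 1) (hz0 : z ≠ 0) :
    HasDerivAt (inv G) (deriv (fun z => G z / z) z)⁻¹ (G z / z) :=
  hasDerivAt_invFunOn (g := fun z => G z / z) isOpen_puncturedBall h.differentiableOn_div
    h.injective (mem_puncturedBall.2 ⟨hz, hz0⟩)

/-- The reciprocal `z / G z` has the nonzero derivative `(G 0)⁻¹` at `0`, so it covers a
neighbourhood of `0`. -/
theorem eventually_cobounded_mem_image (h : IsPolarConcave G) (hs : 0 < s) :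
    ∀ᶠ w in Bornology.cobounded ℂ, w ∈ (fun z => G z / z) '' (ball 0 s \ {0}) := by
  have hd : HasStrictDerivAt (fun z => z / G z) (G 0)⁻¹ 0 := by
    have h1 : HasStrictDerivAt G (deriv G 0) 0 :=
      (h.holomorphic.analyticAt (isOpen_ball.mem_nhds (by simp))).hasStrictDerivAt
    have h2 : HasStrictDerivAt (fun z => z / G z) ((1 * G 0 - id 0 * deriv G 0) / G 0 ^ 2) 0 :=
      (hasStrictDerivAt_id (0 : ℂ)).div h1 h.ne_zero
    have h3 : (1 * G 0 - id 0 * deriv G 0) / G 0 ^ 2 = (G 0)⁻¹ := by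
      have := h.ne_zero
      simp
      field_simp
    rwa [h3] at h2
  have hmap := hd.map_nhds_eq (inv_ne_zero h.ne_zero)
  simp only [zero_div] at hmap
  have h2 : (fun z => z / G z) '' ball 0 s ∈ 𝓝 (0 : ℂ) := by
    rw [← hmap]
    exact image_mem_map (ball_mem_nhds 0 hs)
  have h3 : Tendsto (fun w : ℂ => w⁻¹) (Bornology.cobounded ℂ) (𝓝 0) :=
    tendsto_inv₀_cobounded
  filter_upwards [h3 h2, Bornology.eventually_ne_cobounded (0 : ℂ)] with w hw hw0
  obtain ⟨z, hz, hzw⟩ := hw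
  have hzw : z / G z = w⁻¹ := hzw
  have hz0 : z ≠ 0 := by
    rintro rfl
    simp at hzw
    exact hw0 hzw.symm
  exact ⟨z, ⟨hz, hz0⟩, by simp only; rw [← inv_inj, inv_div, hzw]⟩

theorem tendsto_inv_cobounded (h : IsPolarConcave G) :
    Tendsto (inv G) (Bornology.cobounded ℂ) (𝓝 0) := by
  rw [Metric.tendsto_nhds]
  intro ε hε
  filter_upwards [h.eventually_cobounded_mem_image (lt_min hε one_pos)] with w hw
  obtain ⟨z, hz, rfl⟩ := hw
  obtain ⟨hz1, hz0⟩ := mem_puncturedBall.1 hz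
  rw [h.inv_apply (hz1.trans_le (min_le_right _ _)) hz0]
  simpa using hz1.trans_le (min_le_left _ _)

/-- Preimages of a convergent sequence cannot accumulate at `0`, because `G z = z * w` in the limit
and `G 0 ≠ 0`. -/
theorem isClosed_image_closedBall (h : IsPolarConcave G) (hs : s < 1) :
    IsClosed ((fun z => G z / z) '' (closedBall 0 s \ {0})) := by
  refine IsSeqClosed.isClosed fun u w hu hw => ?_
  choose v hv hvu using hu
  obtain ⟨z, hz, φ, hφ, hφz⟩ := (isCompact_closedBall (0 : ℂ) s).tendsto_subseq fun n => (hv n).1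
  have hz1 : ‖z‖ < 1 := lt_of_le_of_lt (by simpa using hz) hs
  have h1 : Tendsto (fun n => G (v (φ n))) atTop (𝓝 (G z)) := (h.continuousAt hz1).tendsto.comp hφz
  have h2 : Tendsto (fun n => v (φ n) * u (φ n)) atTop (𝓝 (z * w)) := 
    hφz.mul (hw.comp hφ.tendsto_atTop)
  have h3 : G z = z * w := by
    refine tendsto_nhds_unique (h1.congr fun n => ?_) h2
    rw [← hvu]
    exact (mul_div_cancel₀ _ (hv _).2).symm
  have hz0 : z ≠ 0 := by
    rintro rfl
    exact h.ne_zero (by simpa using h3)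
  exact ⟨z, ⟨hz, hz0⟩, by simp only; rw [h3, mul_div_cancel_left₀ _ hz0]⟩

theorem limit_notMem_image (h : IsPolarConcave G) {a : ℕ → ℂ} (ha : ∀ n, ‖a n‖ < 1)
    (ha' : Tendsto (fun n => ‖a n‖) atTop (𝓝 1)) (hw : Tendsto (fun n => G (a n) / a n) atTop (𝓝 w)) :
    w ∈ ((fun z => G z / z) '' (ball 0 1 \ {0}))ᶜ := by
  rintro ⟨z, hz, rfl⟩
  obtain ⟨hz1, hz0⟩ := mem_puncturedBall.1 hz
  have h1 := (h.hasDerivAt_inv hz1 hz0).continuousAt.tendsto.comp hw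
  rw [h.inv_apply hz1 hz0] at h1
  have h2 : Tendsto a atTop (𝓝 z) := by
    refine h1.congr' ?_
    filter_upwards [ha'.eventually (lt_mem_nhds one_pos)] with n hn
    exact h.inv_apply (ha n) (norm_pos_iff.1 hn)
  exact hz1.ne (tendsto_nhds_unique h2.norm ha')

theorem isBounded_compl_image (h : IsPolarConcave G) (hs : 0 < s) :
    Bornology.IsBounded ((fun z => G z / z) '' (ball 0 s \ {0}))ᶜ := by
  rw [Bornology.isBounded_def, compl_compl]
  exact h.eventually_cobounded_mem_image hs

/-- By compactness: otherwise points tending to the unit circle give limit values in the convex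
complement of the image, while their combination lies in the closed image of a smaller disc. -/
theorem eventually_combination_notMem (h : IsPolarConcave G) (hs : s < 1) (ht : t ∈ Icc (0 : ℝ) 1) :
    ∀ᶠ s' in 𝓝[<] (1 : ℝ), ∀ a b : ℂ, ‖a‖ = s' → ‖b‖ = s' →
      (1 - t) * (G a / a) + t * (G b / b) ∉ (fun z => G z / z) '' (closedBall 0 s \ {0}) := by
  by_contra hcon
  obtain ⟨u, hu, hu'⟩ := exists_seq_forall_of_frequently (not_eventually.1 hcon)
  push Not at hu'
  choose a b ha hb hab using hu'
  have hu1 : Tendsto u atTop (𝓝 1) := hu.mono_right nhdsWithin_le_nhds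
  have hult : ∀ᶠ n in atTop, u n < 1 := hu.eventually self_mem_nhdsWithin
  have hugt : ∀ᶠ n in atTop, 1 / 2 < u n := hu1.eventually (lt_mem_nhds (by norm_num))
  obtain ⟨N, hN⟩ := eventually_atTop.1 (hult.and hugt)
  -- By injectivity, values taken at norm greater than `1/2` avoid the image of the disc of radius
  -- `1/2` around the pole, so they stay bounded. Any radius in `(0, 1)` would do.
  have hmem : ∀ c : ℂ, 1 / 2 < ‖c‖ → ‖c‖ < 1 →
      G c / c ∈ ((fun z => G z / z) '' (ball 0 (1 / 2) \ {0}))ᶜ := by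
    rintro c hc hc1 ⟨y, hy, hyc⟩
    obtain ⟨hy1, hy0⟩ := mem_puncturedBall.1 hy
    have hc0 : c ≠ 0 := norm_pos_iff.1 (by linarith)
    have := h.injective (mem_puncturedBall.2 ⟨by linarith, hy0⟩) (mem_puncturedBall.2 ⟨hc1, hc0⟩) hyc
    rw [this] at hy1
    linarith
  have hbdd := (h.isBounded_compl_image (s := 1 / 2) (by norm_num)).prod
    (h.isBounded_compl_image (s := 1 / 2) (by norm_num))
  obtain ⟨⟨w₁, w₂⟩, -, φ, hφ, hlim⟩ := tendsto_subseq_of_bounded hbdd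
    (x := fun n => (G (a (n + N)) / a (n + N), G (b (n + N)) / b (n + N))) (fun n => by
      have := hN (n + N) (by omega)
      exact ⟨hmem _ (by rw [ha]; exact this.2) (by rw [ha]; exact this.1),
        hmem _ (by rw [hb]; exact this.2) (by rw [hb]; exact this.1)⟩)
  have hlim₁ := (continuous_fst.tendsto _).comp hlim
  have hlim₂ := (continuous_snd.tendsto _).comp hlim
  have huN : Tendsto (fun n => u (φ n + N)) atTop (𝓝 1) :=
    hu1.comp ((tendsto_add_atTop_nat N).comp hφ.tendsto_atTop)
  have hw₁ := h.limit_notMem_image (a := fun n => a (φ n + N))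
    (fun n => by rw [ha]; exact (hN _ (by omega)).1) (by simpa only [ha] using huN) hlim₁
  have hw₂ := h.limit_notMem_image (a := fun n => b (φ n + N))
    (fun n => by rw [hb]; exact (hN _ (by omega)).1) (by simpa only [hb] using huN) hlim₂
  have hconv := h.convex_compl hw₁ hw₂ (sub_nonneg.2 ht.2) ht.1 (by ring)
  have hclosed := (h.isClosed_image_closedBall hs).mem_of_tendsto
    ((hlim₁.const_mul (1 - t : ℂ)).add (hlim₂.const_mul (t : ℂ)))
    (Eventually.of_forall fun n => hab (φ n + N))
  refine hconv (image_mono (sdiff_subset_sdiff_left (closedBall_subset_ball hs)) ?_)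
  simpa using hclosed

end IsPolarConcave

/-! ### Convexity on smaller circles -/

namespace IsPolarConcave

variable {G : ℂ → ℂ} {z z₁ z₂ w x : ℂ} {r s t : ℝ}

/-- The complement of the image of a smaller disc is also convex. -/
theorem le_norm_of_combination (h : IsPolarConcave G) (hr : 0 < r) (hr1 : r < 1) (h₁ : ‖z₁‖ = r)
    (h₂ : ‖z₂‖ = r) (ht : t ∈ Icc (0 : ℝ) 1) (hne : (1 - t) / z₁ + t / z₂ ≠ 0) (hx : ‖x‖ < 1)
    (hx0 : x ≠ 0) (hxc : G x / x = (1 - t) * (G z₁ / z₁) + t * (G z₂ / z₂)) : r ≤ ‖x‖ := by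
  by_contra! hlt
  have hz₁ : z₁ ≠ 0 := norm_pos_iff.1 (h₁ ▸ hr)
  have hz₂ : z₂ ≠ 0 := norm_pos_iff.1 (h₂ ▸ hr)
  have hxpos : 0 < ‖x‖ := norm_pos_iff.2 hx0
  -- `C` will bound `l / inv G (c l)`, whose value at `l = 1` has norm `1 / ‖x‖ > C`; here `c l` is
  -- the same combination with both points scaled by `l`. Its norm has limit at most `1 / r` at `l =
  -- 0`, and `s` is taken so near `1` that `1 / (r * s) < C` too.
  obtain ⟨C, hC1, hC2⟩ := exists_between (one_div_lt_one_div_of_lt hxpos hlt)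
  have hCpos : 0 < C := lt_trans (by positivity) hC1
  have hrC : 1 / (r * C) < 1 := by
    rw [div_lt_one (by positivity)]
    rwa [div_lt_iff₀ hr, mul_comm] at hC1
  obtain ⟨s, hs, hs1⟩ := exists_between (max_lt hx hrC)
  have hxs : ‖x‖ < s := (le_max_left _ _).trans_lt hs
  have hs0 : 0 < s := hxpos.trans hxs
  have hsC : 1 / r / s < C := by
    have := (le_max_right _ _).trans_lt hs
    rw [div_lt_iff₀ (by positivity)] at this
    rw [div_lt_iff₀ hs0, div_lt_iff₀ hr]
    linarith
  obtain ⟨s', hcomb, hs'r, hs'1⟩ := ((h.eventually_combination_notMem hs1 ht).and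
    (Ioo_mem_nhdsLT hr1)).exists
  set ρ := s' / r with hρ
  have hρ1 : 1 < ρ := (one_lt_div hr).2 hs'r
  have hρr : ρ < 1 / r := (div_lt_div_iff_of_pos_right hr).2 hs'1
  set A : ℂ → ℂ := fun l => (1 - t) * (G (l * z₁) / z₁) + t * (G (l * z₂) / z₂) with hA
  set c : ℂ → ℂ := fun l =>
    (1 - t) * (G (l * z₁) / (l * z₁)) + t * (G (l * z₂) / (l * z₂)) with hc
  have hcA : ∀ l, c l = A l / l := by
    intro l
    simp only [hc, hA]
    rw [add_div, mul_div_assoc, mul_div_assoc, div_div, div_div, mul_comm l, mul_comm l]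
  have hnorm : ∀ l, ‖l * z₁‖ = ‖l‖ * r ∧ ‖l * z₂‖ = ‖l‖ * r := fun l => by
    simp [h₁, h₂]
  have hcdiff : ∀ l, l ≠ 0 → ‖l‖ < 1 / r → DifferentiableAt ℂ c l := by
    intro l hl hlr
    have hlr' : ‖l‖ * r < 1 := by rwa [lt_div_iff₀ hr] at hlr
    have d₁ : DifferentiableAt ℂ (fun l => G (l * z₁) / (l * z₁)) l :=
      (h.differentiableAt_div (z := l * z₁) (by rw [(hnorm l).1]; exact hlr')
        (mul_ne_zero hl hz₁)).comp (f := fun l => l * z₁) l (by fun_prop)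
    have d₂ : DifferentiableAt ℂ (fun l => G (l * z₂) / (l * z₂)) l :=
      (h.differentiableAt_div (z := l * z₂) (by rw [(hnorm l).2]; exact hlr')
        (mul_ne_zero hl hz₂)).comp (f := fun l => l * z₂) l (by fun_prop)
    exact (d₁.const_mul _).add (d₂.const_mul _)
  -- behaviour at the origin
  have hAlim : Tendsto A (𝓝[≠] 0) (𝓝 (G 0 * ((1 - t) / z₁ + t / z₂))) := by
    have h0 : ∀ v : ℂ, Tendsto (fun l => G (l * v)) (𝓝[≠] 0) (𝓝 (G 0)) := by
      intro v
      refine (h.continuousAt (by simp)).tendsto.comp ?_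
      have : Continuous fun l : ℂ => l * v := by fun_prop
      simpa using (this.tendsto 0).mono_left nhdsWithin_le_nhds
    have := (((h0 z₁).div_const z₁).const_mul (1 - t : ℂ)).add
      (((h0 z₂).div_const z₂).const_mul (t : ℂ))
    convert this using 2
    ring
  have hclim : Tendsto c (𝓝[≠] 0) (Bornology.cobounded ℂ) := by
    have h1 : Tendsto (fun l : ℂ => l⁻¹) (𝓝[≠] 0) (Bornology.cobounded ℂ) :=
      tendsto_inv₀_nhdsNE_zero
    rw [← tendsto_norm_atTop_iff_cobounded] at h1 ⊢
    have h2 := Tendsto.pos_mul_atTop (norm_pos_iff.2 (mul_ne_zero h.ne_zero hne)) hAlim.norm h1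
    refine h2.congr fun l => ?_
    rw [hcA, div_eq_mul_inv, norm_mul]
  have hinv : Tendsto (fun l => inv G (c l)) (𝓝[≠] 0) (𝓝 0) := h.tendsto_inv_cobounded.comp hclim
  -- The quotient equals `A l / G (inv G (c l))`, which has a finite limit because `inv G (c l)`
  -- tends to `0`.
  have hk0 : ∀ᶠ l in 𝓝[≠] (0 : ℂ), ‖l / inv G (c l)‖ < C := by
    have h1 : Tendsto (fun l => A l / G (inv G (c l))) (𝓝[≠] 0)
        (𝓝 (G 0 * ((1 - t) / z₁ + t / z₂) / G 0)) :=
      hAlim.div ((h.continuousAt (by simp)).tendsto.comp hinv) h.ne_zero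
    rw [mul_div_cancel_left₀ _ h.ne_zero] at h1
    have h2 : ‖(1 - t) / z₁ + t / z₂‖ < C := by
      refine lt_of_le_of_lt ((norm_add_le _ _).trans (le_of_eq ?_)) hC1
      have e1 : ‖(1 - t : ℂ)‖ = 1 - t := by
        rw [← Complex.ofReal_one, ← Complex.ofReal_sub, Complex.norm_of_nonneg (sub_nonneg.2 ht.2)]
      rw [norm_div, norm_div, h₁, h₂, e1, Complex.norm_of_nonneg ht.1]
      ring
    filter_upwards [h1.norm.eventually (gt_mem_nhds h2),
      hclim.eventually (h.eventually_cobounded_mem_image one_pos),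
      hAlim.eventually_ne (mul_ne_zero h.ne_zero hne), self_mem_nhdsWithin] with l hl hl' hAl hl0
    obtain ⟨y, hy, hyc⟩ := hl'
    obtain ⟨hy1, hy0⟩ := mem_puncturedBall.1 hy
    have hl0 : l ≠ 0 := hl0
    have hyc : G y / y = c l := hyc
    rw [← hyc, h.inv_apply hy1 hy0] at hl ⊢
    rw [hcA] at hyc
    have hA0 : A l = l * (G y / y) := by rw [hyc, mul_div_cancel₀ _ hl0]
    have hGy : G y ≠ 0 := fun hG => hAl (by rw [hA0, hG, zero_div, mul_zero])
    have e : l / y = A l / G y := by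
      rw [hA0]
      field_simp
    rwa [e]
  obtain ⟨ε', hε', hball⟩ := Metric.eventually_nhds_iff_ball.1 (eventually_nhdsWithin_iff.1 hk0)
  obtain ⟨ε, hε, hεlt⟩ := exists_between (lt_min hε' one_pos)
  have hε1 : ε < 1 := hεlt.trans_le (min_le_right _ _)
  have hkε : ∀ l : ℂ, ‖l‖ = ε → ‖l / inv G (c l)‖ ≤ C := fun l hl =>
    (hball l (by simpa [hl] using hεlt.trans_le (min_le_left _ _))
      (norm_pos_iff.1 (hl ▸ hε))).le
  -- the region for the maximum principle
  set V : Set ℂ := {l | ε < ‖l‖ ∧ ‖l‖ < ρ} ∩ c ⁻¹' ((fun z => G z / z) '' (ball 0 s \ {0})) with hV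
  set K : Set ℂ := {l | ε ≤ ‖l‖ ∧ ‖l‖ ≤ ρ} ∩ c ⁻¹' ((fun z => G z / z) '' (closedBall 0 s \ {0}))
    with hK
  have hcK : ∀ l : ℂ, ε ≤ ‖l‖ → ‖l‖ ≤ ρ → DifferentiableAt ℂ c l := fun l hl hl' =>
    hcdiff l (norm_pos_iff.1 (hε.trans_le hl)) (hl'.trans_lt hρr)
  have hVopen : IsOpen V := by
    refine ContinuousOn.isOpen_inter_preimage (fun l hl =>
      (hcK l hl.1.le hl.2.le).continuousAt.continuousWithinAt) ?_ ?_
    · exact (isOpen_lt continuous_const continuous_norm).inter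
        (isOpen_lt continuous_norm continuous_const)
    · exact isOpen_image_of_injOn isOpen_puncturedBall
        (h.differentiableOn_div.mono (sdiff_subset_sdiff_left (ball_subset_ball hs1.le)))
        (h.injective.mono (sdiff_subset_sdiff_left (ball_subset_ball hs1.le)))
  have hKclosed : IsClosed K := by
    refine ContinuousOn.preimage_isClosed_of_isClosed (fun l hl =>
      (hcK l hl.1 hl.2).continuousAt.continuousWithinAt) ?_ (h.isClosed_image_closedBall hs1)
    exact (isClosed_le continuous_const continuous_norm).inter
        (isClosed_le continuous_norm continuous_const)
  have hVK : closure V ⊆ K := closure_minimal (fun l hl => ⟨⟨hl.1.1.le, hl.1.2.le⟩,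
    image_mono (sdiff_subset_sdiff_left ball_subset_closedBall) hl.2⟩) hKclosed
  have hkdiff : DifferentiableOn ℂ (fun l => l / inv G (c l)) K := by
    rintro l ⟨⟨hl1, hl2⟩, y, hy, hyc⟩
    have hy1 : ‖y‖ < 1 := lt_of_le_of_lt (by simpa using hy.1) hs1
    have hy0 : y ≠ 0 := hy.2
    have hyc : G y / y = c l := hyc
    refine (differentiableAt_id.div ?_ ?_).differentiableWithinAt
    · have := (h.hasDerivAt_inv hy1 hy0).differentiableAt
      rw [hyc] at this
      exact this.comp l (hcK l hl1 hl2)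
    · rwa [← hyc, h.inv_apply hy1 hy0]
  have hVbdd : Bornology.IsBounded V :=
    isBounded_closedBall.subset (t := closedBall (0 : ℂ) ρ) fun l hl => by simpa using hl.1.2.le
  -- Three kinds of frontier points: on `‖l‖ = ε` the estimate near `0` applies; `‖l‖ = ρ` is
  -- excluded by the choice of `s'`; elsewhere the preimage of `c l` has norm `s`, so the quotient
  -- is less than `1 / (r * s)`.
  have hfrontier : ∀ l ∈ frontier V, ‖l / inv G (c l)‖ ≤ C := by
    intro l hl
    rw [frontier, hVopen.interior_eq] at hl
    obtain ⟨⟨hl1, hl2⟩, y, hy, hyc⟩ := hVK hl.1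
    have hys : ‖y‖ ≤ s := by simpa using hy.1
    have hy1 : ‖y‖ < 1 := hys.trans_lt hs1
    have hy0 : y ≠ 0 := hy.2
    have hyc : G y / y = c l := hyc
    rcases hl1.eq_or_lt with hl1 | hl1
    · exact hkε l hl1.symm
    rcases hl2.eq_or_lt with hl2 | hl2
    · have hs'eq : ‖l‖ * r = s' := by rw [hl2, hρ, div_mul_cancel₀ _ hr.ne']
      exact absurd ⟨y, hy, hyc⟩ (hcomb _ _ ((hnorm l).1.trans hs'eq) ((hnorm l).2.trans hs'eq))
    rcases hys.eq_or_lt with hys | hys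
    · rw [← hyc, h.inv_apply hy1 hy0, norm_div, hys]
      refine le_trans ?_ hsC.le
      gcongr
      exact (hl2.trans hρr).le
    · exact absurd ⟨⟨hl1, hl2⟩, y, mem_puncturedBall.2 ⟨hys, hy0⟩, hyc⟩ hl.2
  have hc1 : c 1 = G x / x := by simp [hc, hxc]
  have h1V : (1 : ℂ) ∈ V :=
    ⟨by simpa using ⟨hε1, hρ1⟩, x, mem_puncturedBall.2 ⟨hxs, hx0⟩, hc1.symm⟩
  have := Complex.norm_le_of_forall_mem_frontier_norm_le hVbdd (hkdiff.mono hVK).diffContOnCl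
    hfrontier (subset_closure h1V)
  rw [hc1, h.inv_apply hx hx0, norm_div, norm_one] at this
  linarith

/-- Pull the segment from `G z₁ / z₁` to `G z₂ / z₂` back by `inv G`. The curve starts at `z₁` on
the circle of radius `r` and does not enter the disc, so the right derivative of its squared norm is
nonnegative. -/
theorem div_re_nonneg_of_norm_eq (h : IsPolarConcave G) (hr : 0 < r) (hr1 : r < 1) (h₁ : ‖z₁‖ = r)
    (h₂ : ‖z₂‖ = r) :
    0 ≤ ((G z₂ / z₂ - G z₁ / z₁) / (z₁ * deriv (fun z => G z / z) z₁)).re := by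
  have hz₁ : z₁ ≠ 0 := norm_pos_iff.1 (h₁ ▸ hr)
  have hz₂ : z₂ ≠ 0 := norm_pos_iff.1 (h₂ ▸ hr)
  set D := deriv (fun z => G z / z) z₁
  set d := G z₂ / z₂ - G z₁ / z₁ with hd
  have hinv := h.hasDerivAt_inv (h₁ ▸ hr1) hz₁
  have hline : HasDerivAt (fun t : ℝ => G z₁ / z₁ + t * d) d 0 := by
    simpa using ((Complex.ofRealCLM.hasDerivAt (x := 0)).mul_const d).const_add (G z₁ / z₁)
  have hcurve : HasDerivAt (fun t : ℝ => inv G (G z₁ / z₁ + t * d)) (D⁻¹ * d) 0 := by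
    refine HasDerivAt.comp (h₂ := inv G) (0 : ℝ) ?_ hline
    simpa using hinv
  have h0 : inv G (G z₁ / z₁ + (0 : ℝ) * d) = z₁ := by simpa using h.inv_apply (h₁ ▸ hr1) hz₁
  have hsq := hcurve.norm_sq
  rw [h0] at hsq
  have hslope := hsq.tendsto_slope_zero_right
  have hnonneg : 0 ≤ 2 * inner ℝ z₁ (D⁻¹ * d) := by
    refine ge_of_tendsto hslope ?_
    have hmem : ∀ᶠ t : ℝ in 𝓝 0, G z₁ / z₁ + t * d ∈ (fun z => G z / z) '' (ball 0 1 \ {0}) := by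
      refine hline.continuousAt.eventually_mem ?_
      refine (isOpen_image_of_injOn isOpen_puncturedBall h.differentiableOn_div
        h.injective).mem_nhds ?_
      exact ⟨z₁, mem_puncturedBall.2 ⟨h₁ ▸ hr1, hz₁⟩, by simp⟩
    filter_upwards [hmem.filter_mono nhdsWithin_le_nhds, self_mem_nhdsWithin,
      (gt_mem_nhds (show (0 : ℝ) < 1 / 2 by norm_num)).filter_mono nhdsWithin_le_nhds]
      with t ht ht0 ht1
    have ht0 : 0 < t := ht0
    obtain ⟨x, hx, hxt⟩ := ht
    obtain ⟨hx1, hx0⟩ := mem_puncturedBall.1 hx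
    have hxt : G x / x = G z₁ / z₁ + t * d := hxt
    have hle : r ≤ ‖x‖ := by
      refine h.le_norm_of_combination hr hr1 h₁ h₂ (t := t) ⟨ht0.le, by linarith⟩ ?_ hx1 hx0 ?_
      -- The two terms have norms `(1 - t) / r` and `t / r`, which differ for `t < 1/2`.
      · intro heq
        have h3 : ‖(1 - t : ℂ) / z₁‖ = ‖(t : ℂ) / z₂‖ := by
          rw [eq_neg_of_add_eq_zero_left heq, norm_neg]
        have e1 : ‖(1 - t : ℂ)‖ = 1 - t := by
          rw [← Complex.ofReal_one, ← Complex.ofReal_sub, Complex.norm_of_nonneg (by linarith)]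
        rw [norm_div, norm_div, h₁, h₂, e1, Complex.norm_of_nonneg ht0.le,
          div_left_inj' hr.ne'] at h3
        linarith
      · rw [hxt, hd]
        ring
    simp only [zero_add]
    rw [← hxt, h.inv_apply hx1 hx0]
    simp only [Complex.ofReal_zero, zero_mul, add_zero, h.inv_apply (h₁ ▸ hr1) hz₁, h₁, smul_eq_mul]
    have : r ^ 2 ≤ ‖x‖ ^ 2 := by gcongr
    have : 0 ≤ t⁻¹ := by positivity
    nlinarith
  have e : d / (z₁ * D) = (D⁻¹ * d * (starRingEnd ℂ) z₁) / (r ^ 2 : ℝ) := by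
    have : (starRingEnd ℂ) z₁ * z₁ = (r ^ 2 : ℝ) := by
      rw [mul_comm, Complex.mul_conj, Complex.normSq_eq_norm_sq, h₁]
    rw [← this]
    have hcz : (starRingEnd ℂ) z₁ ≠ 0 := by simpa using hz₁
    by_cases hD : D = 0
    · simp [hD]
    field_simp
  rw [e, Complex.div_ofReal_re]
  rw [Complex.inner] at hnonneg
  refine div_nonneg ?_ (by positivity)
  linarith

end IsPolarConcave

/-! ### The two-point inequality -/

theorem norm_le_norm_of_eventually_nhdsNE {f g : ℂ → ℂ} {a : ℂ} (hf : ContinuousAt f a)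
    (hg : ContinuousAt g a) (h : ∀ᶠ z in 𝓝[≠] a, ‖f z‖ ≤ ‖g z‖) : ‖f a‖ ≤ ‖g a‖ :=
  le_of_tendsto_of_tendsto (hf.norm.tendsto.mono_left nhdsWithin_le_nhds)
    (hg.norm.tendsto.mono_left nhdsWithin_le_nhds) h

/-- The minimum principle for the real part; one boundary point may be left out. -/
theorem re_nonneg_of_forall_sphere {f : ℂ → ℂ} {r : ℝ} {a z : ℂ} (hr0 : 0 < r) (hr : r < 1)
    (hf : DifferentiableOn ℂ f (ball 0 1)) (h : ∀ z, ‖z‖ = r → z ≠ a → 0 ≤ (f z).re)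
    (hz : ‖z‖ ≤ r) : 0 ≤ (f z).re := by
  have hbd : ∀ z, ‖z‖ = r → 0 ≤ (f z).re := by
    intro w hw
    by_cases hwa : w = a
    swap
    · exact h w hw hwa
    subst hwa
    by_cases hw0 : w = 0
    · exact absurd (by rw [← hw, hw0, norm_zero]) hr0.ne'
    have hne : ∀ θ : ℝ, (1 - θ * Complex.I : ℂ) ≠ 0 := by
      intro θ h0
      simpa using congrArg Complex.re h0
    -- A Cayley parametrisation of the circle near `w`, along which the inequality passes to the
    -- exceptional point by continuity.
    set γ : ℝ → ℂ := fun θ => w * ((1 + θ * Complex.I) / (1 - θ * Complex.I)) with hγ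
    have hγc : Continuous γ :=
      continuous_const.mul (Continuous.div (by fun_prop) (by fun_prop) hne)
    have hγ0 : γ 0 = w := by simp [hγ]
    have hγn : ∀ θ, ‖γ θ‖ = r := by
      intro θ
      have : ‖(1 + θ * Complex.I : ℂ)‖ = ‖(1 - θ * Complex.I : ℂ)‖ := by
        rw [← Complex.norm_conj]
        simp [sub_eq_add_neg]
      rw [hγ]
      simp only
      rw [norm_mul, norm_div, this, div_self (norm_ne_zero_iff.2 (hne θ)), mul_one, hw]
    have hγne : ∀ θ, θ ≠ 0 → γ θ ≠ w := by
      intro θ hθ heq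
      have h1 : (1 + θ * Complex.I : ℂ) / (1 - θ * Complex.I) = 1 :=
        mul_left_cancel₀ hw0 (by rw [mul_one]; exact heq)
      rw [div_eq_one_iff_eq (hne θ)] at h1
      have := congrArg Complex.im h1
      simp at this
      exact hθ (by linarith)
    have hcont : ContinuousAt f w :=
      (hf.differentiableAt (isOpen_ball.mem_nhds (by simpa [hw] using hr))).continuousAt
    have hlim : Tendsto (fun θ => (f (γ θ)).re) (𝓝[≠] 0) (𝓝 (f w).re) := by
      refine (Complex.continuous_re.tendsto _).comp (hcont.tendsto.comp ?_)
      rw [← hγ0]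
      exact (hγc.tendsto 0).mono_left nhdsWithin_le_nhds
    refine ge_of_tendsto hlim ?_
    filter_upwards [self_mem_nhdsWithin] with θ hθ using h _ (hγn θ) (hγne θ hθ)
  have hsub : closure (ball (0 : ℂ) r) ⊆ ball 0 1 :=
    closure_ball_subset_closedBall.trans (closedBall_subset_ball hr)
  have hexp : DiffContOnCl ℂ (fun z => Complex.exp (-f z)) (ball 0 r) :=
    ((hf.mono hsub).neg.cexp).diffContOnCl
  have := Complex.norm_le_of_forall_mem_frontier_norm_le isBounded_ball hexp (C := 1) (z := z)
    (fun w hw => by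
      rw [frontier_ball _ hr0.ne', mem_sphere_zero_iff_norm] at hw
      simpa [Complex.norm_exp] using hbd w hw)
    (by rw [closure_ball _ hr0.ne']; simpa using hz)
  simpa [Complex.norm_exp] using this

/-- The holomorphic extension of `z * ζ * (G z / z - G ζ / ζ) / (z - ζ)`. -/
def kernel (G : ℂ → ℂ) (z ζ : ℂ) : ℂ := ζ * dslope G z ζ - G ζ

/-- The difference quotient of the function `kernel G z` at `z`. -/
def kernelSlope (G : ℂ → ℂ) (z ζ : ℂ) : ℂ := dslope (kernel G z) z ζ

section Kernel

variable (G : ℂ → ℂ) (z ζ : ℂ)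

theorem sub_mul_kernel : (z - ζ) * kernel G z ζ = ζ * G z - z * G ζ := by
  have h : (ζ - z) * dslope G z ζ = G ζ - G z := by simpa using sub_smul_dslope G z ζ
  rw [kernel]
  linear_combination -ζ * h

theorem kernel_eq_add : kernel G z ζ = kernel G z z + (ζ - z) * kernelSlope G z ζ := by
  have h : (ζ - z) * kernelSlope G z ζ = kernel G z ζ - kernel G z z := by
    simpa [kernelSlope] using sub_smul_dslope (kernel G z) z ζ
  rw [h]
  ring

theorem kernel_comm : kernel G z ζ = kernel G ζ z := by
  rcases eq_or_ne z ζ with rfl | hne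
  · rfl
  · refine mul_left_cancel₀ (sub_ne_zero.2 hne) ?_
    linear_combination sub_mul_kernel G z ζ + sub_mul_kernel G ζ z

theorem kernel_self : kernel G z z = z * deriv G z - G z := by simp [kernel]

theorem kernel_zero_right : kernel G z 0 = -G 0 := by simp [kernel]

theorem kernel_zero_left : kernel G 0 ζ = -G 0 := by rw [kernel_comm, kernel_zero_right]

end Kernel

namespace IsPolarConcave

variable {G : ℂ → ℂ} {z ζ : ℂ} {r : ℝ}

theorem differentiableOn_kernel (h : IsPolarConcave G) (hz : ‖z‖ < 1) :
    DifferentiableOn ℂ (kernel G z) (ball 0 1) :=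
  (differentiableOn_id.mul ((Complex.differentiableOn_dslope
    (isOpen_ball.mem_nhds (by simpa using hz))).2 h.holomorphic)).sub h.holomorphic

theorem differentiableOn_kernelSlope (h : IsPolarConcave G) (hz : ‖z‖ < 1) :
    DifferentiableOn ℂ (kernelSlope G z) (ball 0 1) :=
  (Complex.differentiableOn_dslope
    (isOpen_ball.mem_nhds (by simpa using hz))).2 (h.differentiableOn_kernel hz)

theorem deriv_div_eq (h : IsPolarConcave G) (hz : ‖z‖ < 1) (hz0 : z ≠ 0) :
    deriv (fun z => G z / z) z = kernel G z z / z ^ 2 := by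
  have h1 := (h.holomorphic.differentiableAt
    (isOpen_ball.mem_nhds (show z ∈ ball (0 : ℂ) 1 by simpa using hz))).hasDerivAt
  rw [kernel_self]
  refine (h1.div (hasDerivAt_id z) hz0).deriv.trans ?_
  simp [mul_comm]

theorem kernel_ne_zero (h : IsPolarConcave G) (hz : ‖z‖ < 1) (hζ : ‖ζ‖ < 1) :
    kernel G z ζ ≠ 0 := by
  rcases eq_or_ne z 0 with rfl | hz0
  · simpa [kernel_zero_left] using h.ne_zero
  rcases eq_or_ne ζ 0 with rfl | hζ0
  · simpa [kernel_zero_right] using h.ne_zero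
  intro hk
  rcases eq_or_ne z ζ with rfl | hne
  · have := deriv_ne_zero_of_injOn isOpen_puncturedBall h.differentiableOn_div h.injective
      (mem_puncturedBall.2 ⟨hz, hz0⟩)
    rw [h.deriv_div_eq hz hz0, hk, zero_div] at this
    exact this rfl
  · have h1 := sub_mul_kernel G z ζ
    rw [hk, mul_zero] at h1
    refine hne (h.injective (mem_puncturedBall.2 ⟨hz, hz0⟩) (mem_puncturedBall.2 ⟨hζ, hζ0⟩) ?_)
    simp only
    rw [div_eq_div_iff hz0 hζ0]
    linear_combination -h1

theorem differentiableOn_quotient_right (h : IsPolarConcave G) (hz : ‖z‖ < 1) :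
    DifferentiableOn ℂ (fun ζ => 1 - 2 * ζ * kernelSlope G z ζ / kernel G z ζ) (ball 0 1) :=
  (differentiableOn_const _).sub ((((differentiableOn_const _).mul differentiableOn_id).mul
    (h.differentiableOn_kernelSlope hz)).div (h.differentiableOn_kernel hz)
    fun _ hζ => h.kernel_ne_zero hz (by simpa using hζ))

/-- The numerator of the Carathéodory function, as a function of the first variable. -/
def numerator (G : ℂ → ℂ) (ζ z : ℂ) : ℂ := (z + ζ) * kernel G ζ z - 2 * ζ * kernel G z z

/-- Two forms of one function: the right side is visibly holomorphic in `ζ`, the left side in `z`,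
also across the diagonal. -/
theorem dslope_numerator (hne : z ≠ ζ) (h : kernel G z ζ ≠ 0) :
    dslope (numerator G ζ) ζ z / kernel G ζ z = 1 - 2 * ζ * kernelSlope G z ζ / kernel G z ζ := by
  have h1 : (z - ζ) * dslope (numerator G ζ) ζ z = numerator G ζ z - numerator G ζ ζ := by
    simpa using sub_smul_dslope (numerator G ζ) ζ z
  have h2 : numerator G ζ ζ = 0 := by
    rw [numerator]
    ring
  rw [kernel_comm G ζ z, div_eq_iff h, sub_mul, div_mul_cancel₀ _ h]
  refine mul_left_cancel₀ (sub_ne_zero.2 hne) ?_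
  rw [h1, h2, numerator, kernel_comm G ζ z, kernel_eq_add G z ζ]
  ring

theorem differentiableOn_quotient_left (h : IsPolarConcave G) (hζ : ‖ζ‖ < 1) :
    DifferentiableOn ℂ (fun z => dslope (numerator G ζ) ζ z / kernel G ζ z) (ball 0 1) := by
  refine DifferentiableOn.div ?_ (h.differentiableOn_kernel hζ)
    fun _ hz => h.kernel_ne_zero hζ (by simpa using hz)
  rw [Complex.differentiableOn_dslope (isOpen_ball.mem_nhds (by simpa using hζ))]
  have h1 : DifferentiableOn ℂ (fun z => kernel G z z) (ball 0 1) := by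
    simp only [kernel_self]
    exact (differentiableOn_id.mul (h.holomorphic.deriv isOpen_ball)).sub h.holomorphic
  exact ((differentiableOn_id.add (differentiableOn_const _)).mul
    (h.differentiableOn_kernel hζ)).sub ((differentiableOn_const _).mul h1)

/-- Up to the factor 2, the reciprocal of the quantity in `div_re_nonneg_of_norm_eq` differs from
this function by `(z + ζ) / (z - ζ)`, which is imaginary on the circle. -/
theorem re_nonneg_of_norm_eq (h : IsPolarConcave G) (hr : 0 < r) (hr1 : r < 1) (hz : ‖z‖ = r)
    (hζ : ‖ζ‖ = r) (hne : ζ ≠ z) :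
    0 ≤ (1 - 2 * ζ * kernelSlope G z ζ / kernel G z ζ).re := by
  have hz0 : z ≠ 0 := norm_pos_iff.1 (hz ▸ hr)
  have hζ0 : ζ ≠ 0 := norm_pos_iff.1 (hζ ▸ hr)
  have hz1 : ‖z‖ < 1 := hz ▸ hr1
  have hζ1 : ‖ζ‖ < 1 := hζ ▸ hr1
  have hk := h.kernel_ne_zero hz1 hζ1
  have hk' := h.kernel_ne_zero hz1 hz1
  have h1 := h.div_re_nonneg_of_norm_eq hr hr1 hz hζ
  have h2 : 0 ≤ (((G ζ / ζ - G z / z) / (z * deriv (fun z => G z / z) z))⁻¹).re := by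
    rw [Complex.inv_re]
    exact div_nonneg h1 (Complex.normSq_nonneg _)
  have hzζ : z - ζ ≠ 0 := sub_ne_zero.2 hne.symm
  have e1 : ((G ζ / ζ - G z / z) / (z * deriv (fun z => G z / z) z))⁻¹ =
      -(ζ * kernel G z z) / ((z - ζ) * kernel G z ζ) := by
    have e2 : G ζ / ζ - G z / z = -((z - ζ) * kernel G z ζ) / (z * ζ) := by
      rw [sub_mul_kernel]
      field_simp
      ring
    rw [e2, h.deriv_div_eq hz1 hz0]
    field_simp
  rw [e1] at h2
  have h3 : ((z + ζ) / (z - ζ)).re = 0 := by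
    rw [Complex.div_re, ← add_div]
    refine div_eq_zero_iff.2 (Or.inl ?_)
    have a1 : Complex.normSq z = Complex.normSq ζ := by
      rw [Complex.normSq_eq_norm_sq, Complex.normSq_eq_norm_sq, hz, hζ]
    rw [Complex.normSq_apply, Complex.normSq_apply] at a1
    simp only [Complex.add_re, Complex.add_im, Complex.sub_re, Complex.sub_im]
    linear_combination a1
  have e3 : 1 - 2 * ζ * kernelSlope G z ζ / kernel G z ζ =
      2 * (-(ζ * kernel G z z) / ((z - ζ) * kernel G z ζ)) + (z + ζ) / (z - ζ) := by
    have h4 := kernel_eq_add G z ζ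
    field_simp
    rw [h4]
    ring
  rw [e3, Complex.add_re, h3, Complex.mul_re]
  simp
  exact h2

/-- The minimum principle on one circle enclosing both points, in `ζ` for fixed `z` on the circle
and then in `z`. -/
theorem quotient_left_re_nonneg (h : IsPolarConcave G) (hz : ‖z‖ < 1) (hζ : ‖ζ‖ < 1) :
    0 ≤ (dslope (numerator G ζ) ζ z / kernel G ζ z).re := by
  obtain ⟨r, hr, hr1⟩ := exists_between (max_lt hz hζ)
  have hzr : ‖z‖ < r := (le_max_left _ _).trans_lt hr
  have hζr : ‖ζ‖ < r := (le_max_right _ _).trans_lt hr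
  have hr0 : 0 < r := (norm_nonneg z).trans_lt hzr
  refine re_nonneg_of_forall_sphere (f := fun z => dslope (numerator G ζ) ζ z / kernel G ζ z)
    (a := ζ) hr0 hr1 (h.differentiableOn_quotient_left hζ) ?_ hzr.le
  intro w hw hwζ
  have hw1 : ‖w‖ < 1 := hw ▸ hr1
  rw [dslope_numerator hwζ (h.kernel_ne_zero hw1 hζ)]
  exact re_nonneg_of_forall_sphere
    (f := fun ζ => 1 - 2 * ζ * kernelSlope G w ζ / kernel G w ζ) (a := w) hr0 hr1 (h.differentiableOn_quotient_right hw1)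
    (fun v hv hvw => h.re_nonneg_of_norm_eq hr0 hr1 hw hv hvw) hζr.le

/-- Schwarz's lemma in `z` for the Cayley transform `(F - 1) / (F + 1)` of the Carathéodory function
`F`, which takes the value `1` at `0`. The diagonal `ζ = z` follows by continuity. -/
theorem norm_mul_kernelSlope_le (h : IsPolarConcave G) (hz : ‖z‖ < 1) (hζ : ‖ζ‖ < 1) :
    ‖ζ * kernelSlope G z ζ‖ ≤ ‖z * (kernel G z z - z * kernelSlope G z ζ)‖ := by
  have hmain : ∀ ζ : ℂ, ‖ζ‖ < 1 → ζ ≠ z →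
      ‖ζ * kernelSlope G z ζ‖ ≤ ‖z * (kernel G z z - z * kernelSlope G z ζ)‖ := by
    intro ζ hζ hne
    rcases eq_or_ne ζ 0 with rfl | hζ0
    · rw [zero_mul, norm_zero]
      exact norm_nonneg _
    set F : ℂ → ℂ := fun z => dslope (numerator G ζ) ζ z / kernel G ζ z with hF
    have hFre : ∀ z ∈ ball (0 : ℂ) 1, 0 ≤ (F z).re := fun z hz =>
      h.quotient_left_re_nonneg (by simpa using hz) hζ
    have hF1 : ∀ z ∈ ball (0 : ℂ) 1, F z + 1 ≠ 0 := by
      intro z hz h0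
      have h1 := hFre z hz
      rw [eq_neg_of_add_eq_zero_left h0] at h1
      norm_num at h1
    have hFd : DifferentiableOn ℂ F (ball 0 1) := h.differentiableOn_quotient_left hζ
    have hFeq : ∀ z : ℂ, ‖z‖ < 1 → ζ ≠ z → F z = 1 - 2 * ζ * kernelSlope G z ζ / kernel G z ζ :=
      fun z hz hne => dslope_numerator hne.symm (h.kernel_ne_zero hz hζ)
    have hF0 : F 0 = 1 := by
      have h1 := kernel_eq_add G 0 ζ
      rw [kernel_zero_left, kernel_zero_left] at h1
      have h2 : ζ * kernelSlope G 0 ζ = 0 := by linear_combination -h1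
      rw [hFeq 0 (by simp) hζ0, mul_assoc, h2]
      simp
    have hC := Complex.norm_le_norm_of_mapsTo_ball (R := 1) (z := z)
      (f := fun z => (F z - 1) / (F z + 1))
      ((hFd.sub (differentiableOn_const _)).div (hFd.add (differentiableOn_const _)) hF1)
      (fun w hw => by
        rw [mem_closedBall_zero_iff, norm_div, div_le_one (norm_pos_iff.2 (hF1 w hw))]
        refine le_of_sq_le_sq ?_ (norm_nonneg _)
        rw [← Complex.normSq_eq_norm_sq, ← Complex.normSq_eq_norm_sq, Complex.normSq_apply,
          Complex.normSq_apply]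
        have := hFre w hw
        simp
        nlinarith)
      (by simp [hF0]) hz
    have hk := h.kernel_ne_zero hz hζ
    rw [norm_div, div_le_iff₀ (norm_pos_iff.2 (hF1 z (by simpa using hz))), hFeq z hz hne,
      ← norm_mul] at hC
    have e1 : 1 - 2 * ζ * kernelSlope G z ζ / kernel G z ζ - 1 =
        -2 / kernel G z ζ * (ζ * kernelSlope G z ζ) := by ring
    have e2 : z * (1 - 2 * ζ * kernelSlope G z ζ / kernel G z ζ + 1) =
        2 / kernel G z ζ * (z * (kernel G z z - z * kernelSlope G z ζ)) := by
      have h4 := kernel_eq_add G z ζ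
      field_simp
      rw [h4]
      ring
    rw [e1, e2, norm_mul, norm_mul (2 / kernel G z ζ), norm_div, norm_div, norm_neg] at hC
    exact le_of_mul_le_mul_left hC (div_pos (by simp) (norm_pos_iff.2 hk))
  rcases eq_or_ne ζ z with rfl | hne
  · have hc : ContinuousAt (kernelSlope G ζ) ζ := ((h.differentiableOn_kernelSlope hζ).differentiableAt
      (isOpen_ball.mem_nhds (by simpa using hζ))).continuousAt
    refine norm_le_norm_of_eventually_nhdsNE (f := fun w => w * kernelSlope G ζ w)
      (g := fun w => ζ * (kernel G ζ ζ - ζ * kernelSlope G ζ w)) (by fun_prop) (by fun_prop) ?_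
    filter_upwards [self_mem_nhdsWithin, nhdsWithin_le_nhds
      (isOpen_ball.mem_nhds (show ζ ∈ ball (0 : ℂ) 1 by simpa using hζ))] with w hw hw1
    exact hmain w (by simpa using hw1) hw
  · exact hmain ζ hζ hne

theorem kernel_sub_ne_zero (h : IsPolarConcave G) (hz : ‖z‖ < 1) (hζ : ‖ζ‖ < 1) :
    kernel G z z - z * kernelSlope G z ζ ≠ 0 := by
  intro h0
  have h1 := h.norm_mul_kernelSlope_le hz hζ
  rw [h0, mul_zero, norm_zero, norm_le_zero_iff] at h1
  refine h.kernel_ne_zero hz hζ ?_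
  rw [kernel_eq_add]
  linear_combination h0 + h1

/-- The two-point inequality for concave functions with pole at the origin. -/
theorem norm_kernelSlope_le (h : IsPolarConcave G) (hz : ‖z‖ < 1) (hζ : ‖ζ‖ < 1) :
    ‖kernelSlope G z ζ‖ ≤ ‖z * (kernel G z z - z * kernelSlope G z ζ)‖ := by
  have hd := h.differentiableOn_kernelSlope hz
  have hmain : ∀ ζ : ℂ, ‖ζ‖ < 1 → ζ ≠ 0 →
      ‖kernelSlope G z ζ‖ ≤ ‖z * (kernel G z z - z * kernelSlope G z ζ)‖ := by
    intro ζ hζ hζ0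
    -- Schwarz's lemma again, now in `ζ`: the quotient is bounded by `‖z‖` and vanishes at `0`,
    -- which removes the factor `ζ`.
    have h1 := Complex.dist_le_div_mul_dist_of_mapsTo_ball (c := 0) (R₁ := 1) (R₂ := ‖z‖) (z := ζ)
      (f := fun ζ => ζ * kernelSlope G z ζ / (kernel G z z - z * kernelSlope G z ζ))
      ((differentiableOn_id.mul hd).div ((differentiableOn_const _).sub (hd.const_mul _))
        fun w hw => h.kernel_sub_ne_zero hz (by simpa using hw))
      (fun w hw => by
        have hw1 : ‖w‖ < 1 := by simpa using hw
        have h2 := h.norm_mul_kernelSlope_le hz hw1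
        simp only [zero_mul, zero_div, mem_closedBall_zero_iff]
        rw [norm_div, div_le_iff₀ (norm_pos_iff.2 (h.kernel_sub_ne_zero hz hw1)), ← norm_mul]
        exact h2) (by simpa using hζ)
    simp only [zero_mul, zero_div, dist_zero_right, div_one] at h1
    rw [norm_div, div_le_iff₀ (norm_pos_iff.2 (h.kernel_sub_ne_zero hz hζ)), norm_mul] at h1
    rw [norm_mul]
    have := norm_pos_iff.2 hζ0
    nlinarith
  rcases eq_or_ne ζ 0 with rfl | hne
  · have hc : ContinuousAt (kernelSlope G z) 0 := (hd.differentiableAt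
      (isOpen_ball.mem_nhds (by simp))).continuousAt
    refine norm_le_norm_of_eventually_nhdsNE (f := fun w => kernelSlope G z w)
      (g := fun w => z * (kernel G z z - z * kernelSlope G z w)) hc (by fun_prop) ?_
    filter_upwards [self_mem_nhdsWithin, nhdsWithin_le_nhds
      (isOpen_ball.mem_nhds (show (0 : ℂ) ∈ ball (0 : ℂ) 1 by simp))] with w hw hw1
    exact hmain w (by simpa using hw1) hw
  · exact hmain ζ hζ hne

end IsPolarConcave

/-! ### The coefficient bound at the pole -/

namespace IsPolarConcave

variable {G : ℂ → ℂ}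

/-- For `ζ = 0` the two-point inequality reads `‖Γ z + z * deriv Γ z‖ ≤ ‖G 0‖` after division by
`z`; let `z → 0`. -/
theorem exists_expansion (h : IsPolarConcave G) :
    ∃ (a : ℂ) (Γ : ℂ → ℂ), DifferentiableOn ℂ Γ (ball 0 1) ∧ ‖Γ 0‖ ≤ ‖G 0‖ ∧
      ∀ z, G z = G 0 + a * z + z ^ 2 * Γ z := by
  have hball : ball (0 : ℂ) 1 ∈ 𝓝 0 := isOpen_ball.mem_nhds (by simp)
  have h1 := (Complex.differentiableOn_dslope hball).2 h.holomorphic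
  have h2 := (Complex.differentiableOn_dslope hball).2 h1
  set Γ := dslope (dslope G 0) 0 with hΓ
  have hG : ∀ z, G z = G 0 + dslope G 0 0 * z + z ^ 2 * Γ z := by
    intro z
    have e1 : z * dslope G 0 z = G z - G 0 := by simpa using sub_smul_dslope G 0 z
    have e2 : z * Γ z = dslope G 0 z - dslope G 0 0 := by
      simpa using sub_smul_dslope (dslope G 0) 0 z
    linear_combination -e1 - z * e2
  refine ⟨dslope G 0 0, Γ, h2, ?_, hG⟩
  have hΓ' := h2.deriv isOpen_ball
  have hcont : ContinuousAt (fun z => Γ z + z * deriv Γ z) 0 :=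
    (h2.differentiableAt hball).continuousAt.add
      (continuousAt_id.mul (hΓ'.differentiableAt hball).continuousAt)
  have := norm_le_norm_of_eventually_nhdsNE (f := fun z => Γ z + z * deriv Γ z) (g := fun _ => G 0)
    hcont continuousAt_const ?_
  · simpa using this
  filter_upwards [self_mem_nhdsWithin, nhdsWithin_le_nhds hball] with z hz0 hz
  have hz0 : z ≠ 0 := hz0
  have hz1 : ‖z‖ < 1 := by simpa using hz
  have hd : deriv G z = dslope G 0 0 + (2 * z * Γ z + z ^ 2 * deriv Γ z) := by
    have h3 := (h2.differentiableAt (isOpen_ball.mem_nhds hz)).hasDerivAt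
    have h4 := (((hasDerivAt_id z).const_mul (dslope G 0 0)).const_add (G 0)).add
      (((hasDerivAt_id z).pow 2).mul h3)
    refine (HasDerivAt.deriv (h4.congr_of_eventuallyEq (Eventually.of_forall fun w => ?_))).trans ?_
    · simpa using hG w
    · simp
  have hself : kernel G z z = -G 0 + z ^ 2 * (Γ z + z * deriv Γ z) := by
    rw [kernel_self, hd, hG z]
    ring
  have hslope : kernelSlope G z 0 = z * (Γ z + z * deriv Γ z) := by
    have h5 := kernel_eq_add G z 0
    rw [kernel_zero_right, hself] at h5
    exact mul_left_cancel₀ hz0 (by linear_combination h5)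
  have hle := h.norm_kernelSlope_le hz1 (ζ := 0) (by simp)
  rw [hslope, hself, norm_mul, norm_mul] at hle
  have := le_of_mul_le_mul_left hle (norm_pos_iff.2 hz0)
  refine this.trans (le_of_eq ?_)
  rw [← norm_neg]
  congr 1
  ring

end IsPolarConcave

/-! ### Passing from the pole `p` to the pole `0` -/

/-- The involutive automorphism of the unit disc that exchanges `0` and `p`. -/
def involution (p : ℝ) (z : ℂ) : ℂ := (p - z) / (1 - p * z)

section Involution

variable {p : ℝ} {z : ℂ}

theorem one_sub_mul_ne_zero (hp : p ∈ Ioo (0 : ℝ) 1) (hz : ‖z‖ < 1) : (1 - p * z : ℂ) ≠ 0 := by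
  intro h
  have h1 : ‖(p * z : ℂ)‖ = 1 := by rw [← sub_eq_zero.1 h, norm_one]
  rw [norm_mul, Complex.norm_of_nonneg hp.1.le] at h1
  nlinarith [hp.1, hp.2, norm_nonneg z]

theorem one_sub_sq_ne_zero (hp : p ∈ Ioo (0 : ℝ) 1) : (1 - p ^ 2 : ℂ) ≠ 0 := by
  have : (1 - p ^ 2 : ℝ) ≠ 0 := by nlinarith [hp.1, hp.2]
  exact_mod_cast this

theorem ofReal_pole_ne_zero (hp : p ∈ Ioo (0 : ℝ) 1) : (p : ℂ) ≠ 0 :=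
  Complex.ofReal_ne_zero.2 hp.1.ne'

theorem norm_pole_lt_one (hp : p ∈ Ioo (0 : ℝ) 1) : ‖(p : ℂ)‖ < 1 := by
  rw [Complex.norm_of_nonneg hp.1.le]
  exact hp.2

theorem norm_involution_lt_one (hp : p ∈ Ioo (0 : ℝ) 1) (hz : ‖z‖ < 1) :
    ‖involution p z‖ < 1 := by
  rw [involution, norm_div, div_lt_one (norm_pos_iff.2 (one_sub_mul_ne_zero hp hz))]
  refine lt_of_pow_lt_pow_left₀ 2 (norm_nonneg _) ?_
  have h1 : Complex.normSq z < 1 := by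
    rw [Complex.normSq_eq_norm_sq]
    nlinarith [norm_nonneg z]
  rw [← Complex.normSq_eq_norm_sq, ← Complex.normSq_eq_norm_sq]
  rw [Complex.normSq_apply] at *
  rw [Complex.normSq_apply]
  simp
  have : 0 < 1 - p ^ 2 := by nlinarith [hp.1, hp.2]
  nlinarith

theorem involution_involution (hp : p ∈ Ioo (0 : ℝ) 1) (hz : ‖z‖ < 1) :
    involution p (involution p z) = z := by
  have h1 := one_sub_mul_ne_zero hp hz
  have h2 := one_sub_mul_ne_zero hp (norm_involution_lt_one hp hz)
  rw [involution, div_eq_iff h2, involution]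
  field_simp
  ring

theorem involution_zero : involution p 0 = p := by simp [involution]

theorem involution_self : involution p p = 0 := by simp [involution]

theorem involution_ne_pole (hp : p ∈ Ioo (0 : ℝ) 1) (hz : ‖z‖ < 1) (hz0 : z ≠ 0) :
    involution p z ≠ p := by
  intro h
  apply hz0
  rw [← involution_involution hp hz, h, involution_self]

theorem involution_ne_zero (hp : p ∈ Ioo (0 : ℝ) 1) (hz : ‖z‖ < 1) (hzp : z ≠ p) :
    involution p z ≠ 0 := by
  intro h
  apply hzp
  rw [← involution_involution hp hz, h, involution_zero]

theorem hasDerivAt_involution (hp : p ∈ Ioo (0 : ℝ) 1) (hz : ‖z‖ < 1) :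
    HasDerivAt (involution p) (-(1 - p ^ 2) / (1 - p * z) ^ 2) z := by
  have h := ((hasDerivAt_id z).const_sub (p : ℂ)).div
    (((hasDerivAt_id z).const_mul (p : ℂ)).const_sub 1) (one_sub_mul_ne_zero hp hz)
  refine HasDerivAt.congr_deriv (f := involution p) h ?_
  congr 1
  simp only [id]
  ring

end Involution

section Concave

variable {p : ℝ} {F : ℂ → ℂ}

theorem IsConcave.exists_isPolarConcave (hp : p ∈ Ioo (0 : ℝ) 1) (h : IsConcave p F) :
    ∃ G : ℂ → ℂ, IsPolarConcave G ∧ ∀ z, z ≠ 0 → G z = z * F (involution p z) := by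
  have hmer : MeromorphicAt F (p : ℂ) := by
    refine meromorphicAt_of_meromorphicOrderAt_ne_zero ?_
    rw [h.simple_pole]
    decide
  obtain ⟨k, hk, hkp, hFk⟩ := (meromorphicOrderAt_eq_int_iff (n := -1) hmer).1 h.simple_pole
  -- The limit of `z * F (involution p z)` at `0`: `F` has residue `k p` at `p`, and the involution
  -- has derivative `-(1 - p ^ 2)` at `0`.
  set c : ℂ := -k p / (1 - p ^ 2) with hc
  have hc0 : c ≠ 0 := div_ne_zero (neg_ne_zero.2 hkp) (one_sub_sq_ne_zero hp)
  set G : ℂ → ℂ := update (fun z => z * F (involution p z)) 0 c with hG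
  have hGz : ∀ z, z ≠ 0 → G z = z * F (involution p z) := fun z hz => by
    simp [hG, update_of_ne hz]
  have hG0 : G 0 = c := by simp [hG]
  have hTd : DifferentiableOn ℂ (involution p) (ball 0 1) := fun z hz =>
    (hasDerivAt_involution hp (by simpa using hz)).differentiableAt.differentiableWithinAt
  have hball : ball (0 : ℂ) 1 ∈ 𝓝 0 := isOpen_ball.mem_nhds (by simp)
  have hTc : ContinuousAt (involution p) 0 := (hTd.differentiableAt hball).continuousAt
  have hdiff : DifferentiableOn ℂ G (ball 0 1) := by
    refine (Complex.differentiableOn_compl_singleton_and_continuousAt_iff hball).1 ⟨?_, ?_⟩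
    · have : DifferentiableOn ℂ (fun z => z * F (involution p z)) (ball 0 1 \ {0}) := by
        refine differentiableOn_id.mul (h.holomorphic.comp (hTd.mono sdiff_subset) fun z hz => ?_)
        have hz1 : ‖z‖ < 1 := by simpa using hz.1
        exact ⟨by simpa using norm_involution_lt_one hp hz1, involution_ne_pole hp hz1 hz.2⟩
      exact this.congr fun z hz => hGz z hz.2
    · rw [continuousAt_iff_punctured_nhds, hG0]
      have hT : Tendsto (involution p) (𝓝[≠] 0) (𝓝[≠] (p : ℂ)) := by
        refine tendsto_nhdsWithin_iff.2 ⟨?_, ?_⟩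
        · simpa [involution_zero] using hTc.tendsto.mono_left nhdsWithin_le_nhds
        · filter_upwards [self_mem_nhdsWithin, nhdsWithin_le_nhds hball] with z hz hz1
          exact involution_ne_pole hp (by simpa using hz1) hz
      have hlim : Tendsto (fun z => -k (involution p z) * (1 - p * z) / (1 - p ^ 2)) (𝓝[≠] 0)
          (𝓝 (-k p * (1 - p * 0) / (1 - p ^ 2))) := by
        refine Tendsto.div_const (Tendsto.mul (Tendsto.neg ?_) ?_) _
        · exact (hk.continuousAt.tendsto.mono_left nhdsWithin_le_nhds).comp hT
        · exact Tendsto.mono_left (Continuous.tendsto (by fun_prop) _) nhdsWithin_le_nhds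
      rw [mul_zero, sub_zero, mul_one] at hlim
      refine hlim.congr' ?_
      filter_upwards [hT.eventually hFk, self_mem_nhdsWithin, nhdsWithin_le_nhds hball]
        with z hz hz0 hz1
      have hz0 : z ≠ 0 := hz0
      have h1 := one_sub_mul_ne_zero hp (z := z) (by simpa using hz1)
      have h2 := one_sub_sq_ne_zero hp
      have e : involution p z - p = -z * (1 - p ^ 2) / (1 - p * z) := by
        rw [involution]
        field_simp
        ring
      rw [hGz z hz0, hz, e, zpow_neg_one, smul_eq_mul]
      field_simp
  have hquot : ∀ z, z ≠ 0 → G z / z = F (involution p z) := fun z hz => by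
    rw [hGz z hz, mul_div_cancel_left₀ _ hz]
  refine ⟨G, ⟨hdiff, by rwa [hG0], ?_, ?_⟩, hGz⟩
  · rintro z ⟨hz, hz0⟩ w ⟨hw, hw0⟩ hzw
    have hz1 : ‖z‖ < 1 := by simpa using hz
    have hw1 : ‖w‖ < 1 := by simpa using hw
    simp only [hquot z hz0, hquot w hw0] at hzw
    have h1 := h.injective (x₁ := involution p z) (x₂ := involution p w)
      (by simpa using norm_involution_lt_one hp hz1) (by simpa using norm_involution_lt_one hp hw1)
      (by simp [toSphere, involution_ne_pole hp hz1 hz0, involution_ne_pole hp hw1 hw0, hzw])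
    rw [← involution_involution hp hz1, h1, involution_involution hp hw1]
  · convert h.convex_compl using 1
    ext w
    simp only [mem_compl_iff, mem_ofPred_eq, not_iff_not]
    constructor
    · rintro ⟨z, ⟨hz, hz0⟩, rfl⟩
      have hz1 : ‖z‖ < 1 := by simpa using hz
      refine ⟨involution p z, by simpa using norm_involution_lt_one hp hz1, ?_⟩
      simp [toSphere, involution_ne_pole hp hz1 hz0, hquot z hz0]
    · rintro ⟨z, hz, hzw⟩
      have hz1 : ‖z‖ < 1 := by simpa using hz
      by_cases hzp : z = p
      · simp [toSphere, hzp] at hzw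
      · have h0 := involution_ne_zero hp hz1 hzp
        refine ⟨involution p z, ⟨by simpa using norm_involution_lt_one hp hz1, h0⟩, ?_⟩
        simp only [hquot _ h0, involution_involution hp hz1]
        simpa [toSphere, hzp] using hzw

theorem one_sub_sq_mul_ne_zero (hp : p ∈ Ioo (0 : ℝ) 1) {l : ℂ} (hl : ‖l‖ ≤ 1) :
    (1 - p ^ 2 * l : ℂ) ≠ 0 := by
  intro h
  have h1 : ‖(p ^ 2 * l : ℂ)‖ = 1 := by rw [← sub_eq_zero.1 h, norm_one]
  rw [norm_mul, norm_pow, Complex.norm_of_nonneg hp.1.le] at h1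
  nlinarith [hp.1, hp.2, norm_nonneg l]

/-- A concave function, moved so that its pole is the origin, expressed by a function from the
disc to the closed disc. -/
theorem IsConcave.exists_representation (hp : p ∈ Ioo (0 : ℝ) 1) (h : IsConcave p F) :
    ∃ G l : ℂ → ℂ, IsPolarConcave G ∧ (∀ z, z ≠ 0 → G z = z * F (involution p z)) ∧
      DifferentiableOn ℂ l (ball 0 1) ∧ (∀ z, ‖z‖ < 1 → ‖l z‖ ≤ 1) ∧
      ∀ z, ‖z‖ < 1 → G z =
        p * (p - z) * (1 - p * z * l z) / ((1 - p ^ 2) * (1 - p ^ 2 * l z)) := by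
  obtain ⟨G, hG, hGF⟩ := h.exists_isPolarConcave hp
  have hp0 := ofReal_pole_ne_zero hp
  have hp1 := norm_pole_lt_one hp
  have hp2 := one_sub_sq_ne_zero hp
  have hGp : G p = 0 := by rw [hGF p hp0, involution_self, h.map_zero, mul_zero]
  -- This is `p²` times the derivative of `F ∘ involution p` at `p`, where `deriv F 0 = 1` enters.
  have hself : kernel G p p = -p ^ 2 / (1 - p ^ 2) := by
    have h0 : (0 : ℂ) ∈ puncturedDisc p := ⟨by simp, hp0.symm⟩
    have hopen : IsOpen (puncturedDisc p) := isOpen_ball.sdiff isClosed_singleton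
    have h1 := (h.holomorphic.differentiableAt (hopen.mem_nhds h0)).hasDerivAt
    rw [h.deriv_zero, ← involution_self (p := p)] at h1
    have h2 := h1.comp (p : ℂ) (hasDerivAt_involution hp hp1)
    have h3 : deriv (fun z => G z / z) p = 1 * (-(1 - p ^ 2) / (1 - p * p) ^ 2) := by
      refine (h2.congr_of_eventuallyEq ?_).deriv
      filter_upwards [isOpen_ne.mem_nhds hp0] with z hz
      rw [hGF z hz, mul_div_cancel_left₀ _ hz]
      rfl
    rw [hG.deriv_div_eq hp1 hp0, div_eq_iff (pow_ne_zero 2 hp0), ← sq] at h3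
    rw [h3]
    field_simp
  set D := kernelSlope G p with hD
  have hne : ∀ z : ℂ, ‖z‖ < 1 → p * D z - kernel G p p ≠ 0 := fun z hz h0 =>
    hG.kernel_sub_ne_zero hp1 hz (by linear_combination -h0)
  have hDd : DifferentiableOn ℂ D (ball 0 1) := hG.differentiableOn_kernelSlope hp1
  -- The two-point inequality at the zero `p` of `G` says exactly that this quotient is bounded by
  -- `1`; solving for `D`, and then for `G`, gives the formula.
  have hl1 : ∀ z : ℂ, ‖z‖ < 1 → ‖D z / (p * (p * D z - kernel G p p))‖ ≤ 1 := by
    intro z hz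
    rw [norm_div, div_le_one (norm_pos_iff.2 (mul_ne_zero hp0 (hne z hz)))]
    have := hG.norm_kernelSlope_le hp1 hz
    rwa [norm_mul, norm_sub_rev, ← norm_mul] at this
  refine ⟨G, fun z => D z / (p * (p * D z - kernel G p p)), hG, hGF, ?_, hl1, ?_⟩
  · exact hDd.div ((differentiableOn_const _).mul ((hDd.const_mul _).sub (differentiableOn_const _)))
      fun z hz => mul_ne_zero hp0 (hne z (by simpa using hz))
  · intro z hz
    have h1 := one_sub_sq_mul_ne_zero hp (hl1 z hz)
    set l := D z / (p * (p * D z - kernel G p p)) with hl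
    have h2 : D z = l * (p * (p * D z - kernel G p p)) := by
      rw [hl, div_mul_cancel₀ _ (mul_ne_zero hp0 (hne z hz))]
    change G z = p * (p - z) * (1 - p * z * l) / ((1 - p ^ 2) * (1 - p ^ 2 * l))
    clear_value l
    rw [hself] at h2
    have h3 : D z = l * p ^ 3 / ((1 - p ^ 2) * (1 - p ^ 2 * l)) := by
      rw [eq_div_iff (mul_ne_zero hp2 h1)]
      field_simp at h2
      linear_combination h2
    have h4 := sub_mul_kernel G p z
    rw [hGp, kernel_eq_add, hself, ← hD, h3] at h4
    refine mul_left_cancel₀ hp0 ?_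
    have h5 : p * G z = -((p - z) * (-p ^ 2 / (1 - p ^ 2) +
        (z - p) * (l * p ^ 3 / ((1 - p ^ 2) * (1 - p ^ 2 * l))))) := by linear_combination h4
    rw [h5]
    field_simp
    ring

/-- Every concave function is of the represented form. -/
theorem IsConcave.exists_omega (hp : p ∈ Ioo (0 : ℝ) 1) (h : IsConcave p F) :
    ∃ ω : ℂ → ℂ, DifferentiableOn ℂ ω (ball 0 1) ∧ MapsTo ω (ball 0 1) (closedBall 0 1) ∧
      ∀ z ∈ puncturedDisc p, F z = (z - p / (1 + (p : ℂ) ^ 2) * (1 + ω z) * z ^ 2) /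
        ((1 - z / p) * (1 - z * p)) := by
  obtain ⟨G, l, -, hGF, hld, hl1, hGl⟩ := h.exists_representation hp
  have hTball : MapsTo (involution p) (ball 0 1) (ball 0 1) := fun z hz => by
    simpa using norm_involution_lt_one hp (by simpa using hz)
  have hTd : DifferentiableOn ℂ (involution p) (ball 0 1) := fun z hz =>
    (hasDerivAt_involution hp (by simpa using hz)).differentiableAt.differentiableWithinAt
  have hmd := hld.comp hTd hTball
  have hm1 : ∀ z ∈ ball (0 : ℂ) 1, ‖l (involution p z)‖ ≤ 1 := fun z hz =>
    hl1 _ (by simpa using hTball hz)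
  -- Equating the two formulas for `F z` and solving for `ω z` gives a Möbius map of the closed disc
  -- applied to `l`.
  refine ⟨fun z => (p ^ 2 - l (involution p z)) / (1 - p ^ 2 * l (involution p z)), ?_, ?_, ?_⟩
  · exact ((differentiableOn_const _).sub hmd).div
      ((differentiableOn_const _).sub (hmd.const_mul _)) fun z hz =>
        one_sub_sq_mul_ne_zero hp (hm1 z hz)
  · intro z hz
    have h1 := hm1 z hz
    set m := l (involution p z)
    rw [mem_closedBall_zero_iff, norm_div,
      div_le_one (norm_pos_iff.2 (one_sub_sq_mul_ne_zero hp h1))]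
    refine le_of_sq_le_sq ?_ (norm_nonneg _)
    have h2 : Complex.normSq m ≤ 1 := by
      rw [Complex.normSq_eq_norm_sq]
      nlinarith [norm_nonneg m]
    rw [← Complex.normSq_eq_norm_sq, ← Complex.normSq_eq_norm_sq]
    have e : ((p : ℂ) ^ 2) = ((p ^ 2 : ℝ) : ℂ) := by push_cast; rfl
    rw [e]
    rw [Complex.normSq_apply] at *
    rw [Complex.normSq_apply]
    simp only [Complex.sub_re, Complex.sub_im, Complex.ofReal_re, Complex.ofReal_im, Complex.mul_re,
      Complex.mul_im, Complex.one_re, Complex.one_im]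
    have : 0 ≤ 1 - p ^ 4 := by
      have := pow_le_one₀ (n := 4) hp.1.le hp.2.le
      linarith
    nlinarith
  · rintro z ⟨hz, hzp⟩
    have hz1 : ‖z‖ < 1 := by simpa using hz
    have hzp : z ≠ p := hzp
    have h0 := involution_ne_zero hp hz1 hzp
    have hT1 := norm_involution_lt_one hp hz1
    have hF := hGl _ hT1
    rw [hGF _ h0, involution_involution hp hz1] at hF
    have h1 := one_sub_sq_mul_ne_zero hp (hm1 z hz)
    have hp0 := ofReal_pole_ne_zero hp
    have hp2 := one_sub_sq_ne_zero hp
    have hp3 : (1 + p ^ 2 : ℂ) ≠ 0 := by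
      have : (1 + p ^ 2 : ℝ) ≠ 0 := by positivity
      exact_mod_cast this
    have h2 := one_sub_mul_ne_zero hp hz1
    have h2' : (1 - z * p : ℂ) ≠ 0 := by rwa [mul_comm]
    have h3 : (p - z : ℂ) ≠ 0 := sub_ne_zero.2 hzp.symm
    have h3' : (1 - z / p : ℂ) ≠ 0 := by
      rw [one_sub_div hp0]
      exact div_ne_zero h3 hp0
    set m := l (involution p z)
    have hF' : F z = p * (p - involution p z) * (1 - p * involution p z * m) /
        ((1 - p ^ 2) * (1 - p ^ 2 * m)) / involution p z := by
      rw [← hF, mul_div_cancel_left₀ _ h0]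
    change F z = (z - p / (1 + (p : ℂ) ^ 2) * (1 + (p ^ 2 - m) / (1 - p ^ 2 * m)) * z ^ 2) /
        ((1 - z / p) * (1 - z * p))
    clear_value m
    rw [hF', involution]
    have e : (1 - z / p : ℂ) = (p - z) / p := one_sub_div hp0
    have e2 : (1 - z * p : ℂ) = 1 - p * z := by ring
    rw [e, e2]
    field_simp
    ring

end Concave

/-! ### The represented class is closed and convex -/

section Topology

variable {p : ℝ} {z : ℂ}

theorem isOpen_puncturedDisc : IsOpen (puncturedDisc p) := isOpen_ball.sdiff isClosed_singleton

theorem exists_extension_of_norm_le {U : Set ℂ} {c : ℂ} {g : ℂ → ℂ} (hU : IsOpen U) (hc : c ∈ U)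
    (hg : DifferentiableOn ℂ g (U \ {c})) (hg1 : ∀ z ∈ U \ {c}, ‖g z‖ ≤ 1) :
    ∃ k : ℂ → ℂ, DifferentiableOn ℂ k U ∧ (∀ z ∈ U \ {c}, k z = g z) ∧ ∀ z ∈ U, ‖k z‖ ≤ 1 := by
  have hUc := hU.mem_nhds hc
  have hd := Complex.differentiableOn_update_limUnder_of_bddAbove hUc hg ⟨1, by
    rintro _ ⟨z, hz, rfl⟩
    exact hg1 z hz⟩
  have heq : ∀ z ∈ U \ {c}, update g c (limUnder (𝓝[≠] c) g) z = g z := fun z hz =>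
    update_of_ne hz.2 _ _
  refine ⟨_, hd, heq, fun z hz => ?_⟩
  by_cases hzc : z = c
  · subst hzc
    have := norm_le_norm_of_eventually_nhdsNE (g := fun _ => 1)
      (hd.differentiableAt hUc).continuousAt continuousAt_const ?_
    · simpa using this
    filter_upwards [self_mem_nhdsWithin, nhdsWithin_le_nhds hUc] with w hw hwU
    rw [heq w ⟨hwU, hw⟩, norm_one]
    exact hg1 w ⟨hwU, hw⟩
  · rw [heq z ⟨hz, hzc⟩]
    exact hg1 z ⟨hz, hzc⟩

/-- The extension by zero of a function on the punctured disc. -/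
def extend (f : C(puncturedDisc p, ℂ)) (z : ℂ) : ℂ :=
  open Classical in if h : z ∈ puncturedDisc p then f ⟨z, h⟩ else 0

theorem extend_apply (f : C(puncturedDisc p, ℂ)) (hz : z ∈ puncturedDisc p) :
    extend f z = f ⟨z, hz⟩ := dif_pos hz

theorem tendstoLocallyUniformlyOn_extend {l : Filter C(puncturedDisc p, ℂ)}
    {f : C(puncturedDisc p, ℂ)} (hl : l ≤ 𝓝 f) :
    TendstoLocallyUniformlyOn extend (extend f) l (puncturedDisc p) := by
  have : LocallyCompactSpace (puncturedDisc p) := isOpen_puncturedDisc.locallyCompactSpace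
  rw [tendstoLocallyUniformlyOn_iff_tendstoLocallyUniformly_comp_coe]
  have h := ContinuousMap.tendsto_iff_tendstoLocallyUniformly.1 (tendsto_id'.2 hl)
  convert h using 2 with g
  · ext z
    exact extend_apply g z.2
  · ext z
    exact extend_apply f z.2

theorem continuousOn_extend (f : C(puncturedDisc p, ℂ)) :
    ContinuousOn (extend f) (puncturedDisc p) := by
  rw [continuousOn_iff_continuous_domRestrict]
  convert f.continuous using 1
  ext z
  exact extend_apply f z.2

/-- The function that represents a given function of the punctured disc. -/
def coefficient (p : ℝ) (F : ℂ → ℂ) (z : ℂ) : ℂ :=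
  (1 + (p : ℂ) ^ 2) / p * ((z - F z * ((1 - z / p) * (1 - z * p))) / z ^ 2) - 1

theorem one_add_sq_ne_zero : (1 + p ^ 2 : ℂ) ≠ 0 := by
  have : (1 + p ^ 2 : ℝ) ≠ 0 := by positivity
  exact_mod_cast this

theorem denominator_ne_zero (hp : p ∈ Ioo (0 : ℝ) 1) (hz : z ∈ puncturedDisc p) :
    (1 - z / p) * (1 - z * p) ≠ (0 : ℂ) := by
  have hz1 : ‖z‖ < 1 := by simpa using hz.1
  have hzp : z ≠ p := hz.2
  have hp0 := ofReal_pole_ne_zero hp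
  refine mul_ne_zero ?_ ?_
  · rw [one_sub_div hp0]
    exact div_ne_zero (sub_ne_zero.2 hzp.symm) hp0
  · rw [mul_comm]
    exact one_sub_mul_ne_zero hp hz1

theorem eq_iff_coefficient_eq (hp : p ∈ Ioo (0 : ℝ) 1) (hz : z ∈ puncturedDisc p) (hz0 : z ≠ 0)
    {F : ℂ → ℂ} {w : ℂ} :
    F z = (z - p / (1 + (p : ℂ) ^ 2) * (1 + w) * z ^ 2) / ((1 - z / p) * (1 - z * p)) ↔
      coefficient p F z = w := by
  have hp0 := ofReal_pole_ne_zero hp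
  have hp3 := one_add_sq_ne_zero (p := p)
  have hD := denominator_ne_zero hp hz
  rw [coefficient, eq_div_iff hD, sub_eq_iff_eq_add]
  generalize F z * ((1 - z / p) * (1 - z * p)) = N
  constructor
  · rintro rfl
    field_simp
    ring
  · intro h
    rw [div_mul_div_comm, div_eq_iff (mul_ne_zero hp0 (pow_ne_zero 2 hz0))] at h
    field_simp
    linear_combination -h

theorem convex_representedClass : Convex ℝ (representedClass p) := by
  rintro f ⟨ω₁, hd₁, hm₁, hf⟩ g ⟨ω₂, hd₂, hm₂, hg⟩ a b ha hb hab
  refine ⟨fun z => a • ω₁ z + b • ω₂ z, (hd₁.const_smul a).add (hd₂.const_smul b), fun z hz =>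
    convex_closedBall 0 1 (hm₁ hz) (hm₂ hz) ha hb hab, fun z => ?_⟩
  have hab' : (a : ℂ) = 1 - b := by
    rw [eq_sub_iff_add_eq]
    exact_mod_cast hab
  simp only [ContinuousMap.add_apply, ContinuousMap.smul_apply, hf, hg, Complex.real_smul]
  rw [hab']
  ring

/-- A limit is holomorphic by Weierstrass' theorem. Away from `0` and `p` the function `ω` is
recovered by `coefficient`, so the bound by `1` survives pointwise, and both singularities are then
removable. -/
theorem isClosed_representedClass (hp : p ∈ Ioo (0 : ℝ) 1) : IsClosed (representedClass p) := by
  refine isClosed_of_closure_subset fun f hf => ?_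
  rw [mem_closure_iff_nhdsWithin_neBot] at hf
  have hle : 𝓝[representedClass p] f ≤ 𝓝 f := nhdsWithin_le_nhds
  have hmem : ∀ᶠ g in 𝓝[representedClass p] f, g ∈ representedClass p := self_mem_nhdsWithin
  have hp0 := ofReal_pole_ne_zero hp
  have hunif := tendstoLocallyUniformlyOn_extend hle
  have hpt : ∀ z ∈ puncturedDisc p,
      Tendsto (fun g => extend g z) (𝓝[representedClass p] f) (𝓝 (extend f z)) :=
    fun z hz => hunif.tendsto_at hz
  have h0mem : (0 : ℂ) ∈ puncturedDisc p := ⟨by simp, hp0.symm⟩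
  have hhol : DifferentiableOn ℂ (extend f) (puncturedDisc p) := by
    refine hunif.differentiableOn (hmem.mono fun g hg => ?_) isOpen_puncturedDisc
    obtain ⟨ω, hd, -, hg⟩ := hg
    have h1 : DifferentiableOn ℂ (fun z => (z - p / (1 + (p : ℂ) ^ 2) * (1 + ω z) * z ^ 2) /
        ((1 - z / p) * (1 - z * p))) (puncturedDisc p) := by
      have hω : DifferentiableOn ℂ ω (puncturedDisc p) := hd.mono sdiff_subset
      exact DifferentiableOn.div (by fun_prop) (by fun_prop) fun z hz => denominator_ne_zero hp hz
    exact h1.congr fun z hz => (extend_apply g hz).trans (hg ⟨z, hz⟩)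
  have hzero : extend f 0 = 0 := by
    refine tendsto_nhds_unique (hpt 0 h0mem) (tendsto_const_nhds.congr' ?_)
    filter_upwards [hmem] with g hg
    obtain ⟨ω, -, -, hg⟩ := hg
    rw [extend_apply g h0mem, hg]
    simp
  have hle1 : ∀ z ∈ puncturedDisc p, z ≠ 0 → ‖coefficient p (extend f) z‖ ≤ 1 := by
    intro z hz hz0
    have hlim : Tendsto (fun g => coefficient p (extend g) z) (𝓝[representedClass p] f)
        (𝓝 (coefficient p (extend f) z)) :=
      ((((hpt z hz).mul_const _).const_sub z).div_const _).const_mul _ |>.sub_const 1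
    refine le_of_tendsto hlim.norm ?_
    filter_upwards [hmem] with g hg
    obtain ⟨ω, -, hm, hg⟩ := hg
    rw [(eq_iff_coefficient_eq hp hz hz0 (F := extend g) (w := ω z)).1
      ((extend_apply g hz).trans (hg ⟨z, hz⟩))]
    simpa using hm hz.1
  have hcd : DifferentiableOn ℂ (coefficient p (extend f)) ((ball 0 1 \ {0}) \ {(p : ℂ)}) := by
    have h1 : DifferentiableOn ℂ (extend f) ((ball 0 1 \ {0}) \ {(p : ℂ)}) :=
      hhol.mono fun z hz => ⟨hz.1.1, hz.2⟩
    refine DifferentiableOn.sub_const (DifferentiableOn.const_mul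
      (DifferentiableOn.div (by fun_prop) (by fun_prop) fun z hz => pow_ne_zero 2 hz.1.2) _) _
  have hpball : (p : ℂ) ∈ ball (0 : ℂ) 1 := by simpa using norm_pole_lt_one hp
  obtain ⟨k, hkd, hk, hk1⟩ := exists_extension_of_norm_le (isOpen_ball.sdiff isClosed_singleton)
    ⟨hpball, hp0⟩ hcd fun z hz => hle1 z ⟨hz.1.1, hz.2⟩ hz.1.2
  obtain ⟨ω, hωd, hω, hω1⟩ := exists_extension_of_norm_le isOpen_ball
    (show (0 : ℂ) ∈ ball (0 : ℂ) 1 by simp) hkd hk1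
  refine ⟨ω, hωd, fun z hz => by simpa using hω1 z hz, ?_⟩
  rintro ⟨z, hz⟩
  rw [← extend_apply f hz]
  rcases eq_or_ne z 0 with rfl | hz0
  · simp [hzero]
  · rw [eq_iff_coefficient_eq hp hz hz0, hω z ⟨hz.1, hz0⟩, hk z ⟨⟨hz.1, hz0⟩, hz.2⟩]

theorem Co_subset_representedClass (hp : p ∈ Ioo (0 : ℝ) 1) : Co p ⊆ representedClass p := by
  rintro f ⟨F, hF, hf⟩
  obtain ⟨ω, hd, hm, h⟩ := hF.exists_omega hp
  exact ⟨ω, hd, hm, fun z => (hf z).trans (h z z.2)⟩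

end Topology

/-! ### A coefficient of the Laurent expansion at the pole -/

section Laurent

variable {p : ℝ}

/-- The coefficient of `z - p` in the Laurent expansion at `p`. -/
def laurentCoeff (f : C(puncturedDisc p, ℂ)) : ℂ := Complex.cderiv ((1 - p) / 2) (extend f) p

theorem sphere_subset (hp : p ∈ Ioo (0 : ℝ) 1) :
    sphere (p : ℂ) ((1 - p) / 2) ⊆ puncturedDisc p := by
  intro z hz
  rw [mem_sphere_iff_norm] at hz
  have h1 : ‖z‖ ≤ ‖z - p‖ + ‖(p : ℂ)‖ := by simpa using norm_add_le (z - p) p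
  rw [hz, Complex.norm_of_nonneg hp.1.le] at h1
  refine ⟨by simpa using by linarith [hp.2], ?_⟩
  rintro rfl
  simp at hz
  linarith [hp.2]

theorem closedBall_subset (hp : p ∈ Ioo (0 : ℝ) 1) :
    closedBall (p : ℂ) ((1 - p) / 2) ⊆ ball 0 1 := by
  intro z hz
  rw [mem_closedBall_iff_norm] at hz
  have h1 : ‖z‖ ≤ ‖z - p‖ + ‖(p : ℂ)‖ := by simpa using norm_add_le (z - p) p
  rw [Complex.norm_of_nonneg hp.1.le] at h1
  simpa using by linarith [hp.2]

theorem continuous_laurentCoeff (hp : p ∈ Ioo (0 : ℝ) 1) :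
    Continuous (laurentCoeff : C(puncturedDisc p, ℂ) → ℂ) := by
  have hρ : 0 < (1 - p) / 2 := by linarith [hp.2]
  rw [continuous_iff_continuousAt]
  intro f
  rw [ContinuousAt, Metric.tendsto_nhds]
  intro ε hε
  have h1 := (tendstoLocallyUniformlyOn_iff_forall_isCompact isOpen_puncturedDisc).1
    (tendstoLocallyUniformlyOn_extend (le_refl (𝓝 f))) _ (sphere_subset hp) (isCompact_sphere _ _)
  filter_upwards [Metric.tendstoUniformlyOn_iff.1 h1 (ε * ((1 - p) / 2)) (by positivity)] with g hg
  have := Complex.norm_cderiv_sub_lt (z := (p : ℂ)) hρ (M := ε * ((1 - p) / 2)) (f := extend g)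
    (g := extend f) (fun w hw => by rw [← dist_eq_norm, dist_comm]; exact hg w hw)
    ((continuousOn_extend g).mono (sphere_subset hp))
    ((continuousOn_extend f).mono (sphere_subset hp))
  rw [mul_div_cancel_right₀ _ hρ.ne'] at this
  rwa [dist_eq_norm]

theorem circleIntegrable_laurent (hp : p ∈ Ioo (0 : ℝ) 1) (f : C(puncturedDisc p, ℂ)) :
    CircleIntegrable (fun w => ((w - p) ^ 2)⁻¹ • extend f w) p ((1 - p) / 2) := by
  have hρ : 0 < (1 - p) / 2 := by linarith [hp.2]
  refine ContinuousOn.circleIntegrable hρ.le ?_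
  refine ContinuousOn.smul (f := fun w : ℂ => ((w - p) ^ 2)⁻¹)
    (ContinuousOn.inv₀ (by fun_prop) fun w hw => ?_) ((continuousOn_extend f).mono (sphere_subset hp))
  exact pow_ne_zero 2 (sub_ne_zero.2 (sphere_subset hp hw).2)

theorem laurentCoeff_combination (hp : p ∈ Ioo (0 : ℝ) 1) (f g : C(puncturedDisc p, ℂ)) (a b : ℝ) :
    laurentCoeff (a • f + b • g) = a • laurentCoeff f + b • laurentCoeff g := by
  have hρ : 0 < (1 - p) / 2 := by linarith [hp.2]
  have h1 : (∮ w in C(p, (1 - p) / 2), ((w - p) ^ 2)⁻¹ • extend (a • f + b • g) w) =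
      ∮ w in C(p, (1 - p) / 2), ((a : ℂ) • (((w - p) ^ 2)⁻¹ • extend f w) +
        (b : ℂ) • (((w - p) ^ 2)⁻¹ • extend g w)) := by
    refine circleIntegral.integral_congr hρ.le fun w hw => ?_
    have hw := sphere_subset hp hw
    simp only [extend_apply _ hw, ContinuousMap.add_apply, ContinuousMap.smul_apply,
      Complex.real_smul, smul_eq_mul]
    ring
  have hi : ∀ (c : ℂ) (k : C(puncturedDisc p, ℂ)),
      CircleIntegrable (fun w => c • (((w - p) ^ 2)⁻¹ • extend k w)) p ((1 - p) / 2) :=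
    fun c k => (circleIntegrable_laurent hp k).const_smul
  simp only [laurentCoeff, Complex.cderiv]
  rw [h1, circleIntegral.integral_add (hi a f) (hi b g), circleIntegral.integral_smul,
    circleIntegral.integral_smul]
  simp only [Complex.real_smul, smul_eq_mul]
  ring

/-- The polar part contributes a multiple of `∮ (w - p)⁻³ = 0`; the rest is Cauchy's formula for the
derivative. -/
theorem laurentCoeff_eq_deriv (hp : p ∈ Ioo (0 : ℝ) 1) {f : C(puncturedDisc p, ℂ)} {α : ℂ}
    {φ : ℂ → ℂ} (hφ : DifferentiableOn ℂ φ (ball 0 1))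
    (hf : ∀ z : puncturedDisc p, f z = α / (z - p) + φ z) : laurentCoeff f = deriv φ p := by
  have hρ : 0 < (1 - p) / 2 := by linarith [hp.2]
  have hne : ∀ w ∈ sphere (p : ℂ) ((1 - p) / 2), w - p ≠ 0 := fun w hw =>
    sub_ne_zero.2 (sphere_subset hp hw).2
  have h1 : (∮ w in C(p, (1 - p) / 2), ((w - p) ^ 2)⁻¹ • extend f w) =
      ∮ w in C(p, (1 - p) / 2), (α • (w - p) ^ (-3 : ℤ) + ((w - p) ^ 2)⁻¹ • φ w) := by
    refine circleIntegral.integral_congr hρ.le fun w hw => ?_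
    have h2 := hne w hw
    have hw := sphere_subset hp hw
    simp only [extend_apply _ hw, hf, smul_eq_mul]
    rw [zpow_neg, show (3 : ℤ) = ((3 : ℕ) : ℤ) by rfl, zpow_natCast]
    field_simp
  have hi1 : CircleIntegrable (fun w : ℂ => α • (w - p) ^ (-3 : ℤ)) p ((1 - p) / 2) := by
    have hc : ContinuousOn (fun w : ℂ => (w - p) ^ (-3 : ℤ)) (sphere (p : ℂ) ((1 - p) / 2)) :=
      ContinuousOn.zpow₀ (by fun_prop) _ fun w hw => Or.inl (hne w hw)
    exact (hc.const_smul α).circleIntegrable hρ.le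
  have hi2 : CircleIntegrable (fun w : ℂ => ((w - p) ^ 2)⁻¹ • φ w) p ((1 - p) / 2) := by
    refine ContinuousOn.circleIntegrable hρ.le (ContinuousOn.smul (ContinuousOn.inv₀ (by fun_prop)
      fun w hw => pow_ne_zero 2 (hne w hw)) (hφ.continuousOn.mono fun w hw =>
        (sphere_subset hp hw).1))
  rw [← Complex.cderiv_eq_deriv isOpen_ball hφ hρ (closedBall_subset hp), laurentCoeff,
    Complex.cderiv, Complex.cderiv, h1, circleIntegral.integral_add hi1 hi2,
    circleIntegral.integral_smul, circleIntegral.integral_sub_zpow_of_ne (by decide), smul_zero,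
    zero_add]

/-- Put `T = involution p`. Then `F = G 0 / T + a + T * Γ(T)`, and `1 / T` is a constant plus a
multiple of `1 / (z - p)`. So the coefficient is `T'(p) * Γ 0 = -Γ 0 / (1 - p²)`, where `‖Γ 0‖ ≤ ‖G
0‖ ≤ p² / (1 - p²)²`. -/
theorem norm_laurentCoeff_le (hp : p ∈ Ioo (0 : ℝ) 1) {f : C(puncturedDisc p, ℂ)} (hf : f ∈ Co p) :
    ‖laurentCoeff f‖ ≤ p ^ 2 / (1 - p ^ 2) ^ 3 := by
  obtain ⟨F, hF, hfF⟩ := hf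
  obtain ⟨G, l, hG, hGF, -, hl1, hGl⟩ := hF.exists_representation hp
  obtain ⟨a, Γ, hΓd, hΓ0, hexp⟩ := hG.exists_expansion
  have hp0 := ofReal_pole_ne_zero hp
  have hp2 := one_sub_sq_ne_zero hp
  have hpos : 0 < 1 - p ^ 2 := by nlinarith [hp.1, hp.2]
  have hnorm : ‖(1 - p ^ 2 : ℂ)‖ = 1 - p ^ 2 := by
    have : (1 - p ^ 2 : ℂ) = ((1 - p ^ 2 : ℝ) : ℂ) := by push_cast; rfl
    rw [this, Complex.norm_of_nonneg hpos.le]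
  have hG0 : ‖G 0‖ ≤ p ^ 2 / (1 - p ^ 2) ^ 2 := by
    have h1 : ‖(0 : ℂ)‖ < 1 := by simp
    have h2 : 1 - p ^ 2 ≤ ‖(1 - p ^ 2 * l 0 : ℂ)‖ := by
      have h3 := norm_sub_norm_le (1 : ℂ) (p ^ 2 * l 0)
      rw [norm_one, norm_mul, norm_pow, Complex.norm_of_nonneg hp.1.le] at h3
      nlinarith [hl1 0 h1, sq_nonneg p]
    have h4 : G 0 = p ^ 2 / ((1 - p ^ 2) * (1 - p ^ 2 * l 0)) := by
      rw [hGl 0 h1]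
      ring
    rw [h4, norm_div, norm_mul, hnorm, norm_pow, Complex.norm_of_nonneg hp.1.le, sq (1 - p ^ 2)]
    gcongr
  have hTd : DifferentiableOn ℂ (involution p) (ball 0 1) := fun z hz =>
    (hasDerivAt_involution hp (by simpa using hz)).differentiableAt.differentiableWithinAt
  have hTball : MapsTo (involution p) (ball 0 1) (ball 0 1) := fun z hz => by
    simpa using norm_involution_lt_one hp (by simpa using hz)
  have hd : DifferentiableOn ℂ
      (fun z => G 0 * p + a + involution p z * Γ (involution p z)) (ball 0 1) :=
    (hTd.mul (hΓd.comp hTd hTball)).const_add _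
  have hrep := laurentCoeff_eq_deriv hp (f := f) (α := -(G 0 * (1 - p ^ 2))) hd (by
    rintro ⟨z, hz⟩
    have hz1 : ‖z‖ < 1 := by simpa using hz.1
    have hzp : z ≠ p := hz.2
    have h0 := involution_ne_zero hp hz1 hzp
    have h1 : F z = G (involution p z) / involution p z := by
      rw [hGF _ h0, involution_involution hp hz1, mul_div_cancel_left₀ _ h0]
    rw [hfF, h1, hexp]
    have h2 : (G 0 + a * involution p z + involution p z ^ 2 * Γ (involution p z)) /
        involution p z = G 0 * (involution p z)⁻¹ + a + involution p z * Γ (involution p z) := by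
      field_simp
    have h3 : (involution p z)⁻¹ = p - (1 - p ^ 2) / (z - p) := by
      rw [involution, inv_div]
      have e1 : (p - z : ℂ) ≠ 0 := sub_ne_zero.2 hzp.symm
      have e2 : (z - p : ℂ) ≠ 0 := sub_ne_zero.2 hzp
      rw [div_eq_iff e1]
      field_simp
      ring
    simp only
    rw [h2, h3]
    ring)
  have hderiv : deriv (fun z => G 0 * p + a + involution p z * Γ (involution p z)) p =
      -Γ 0 / (1 - p ^ 2) := by
    have h1 := hasDerivAt_involution hp (norm_pole_lt_one hp)
    have h2 : HasDerivAt Γ (deriv Γ 0) (involution p p) := by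
      rw [involution_self]
      exact (hΓd.differentiableAt (isOpen_ball.mem_nhds (by simp))).hasDerivAt
    have h3 := (h1.mul (h2.comp (p : ℂ) h1)).const_add (G 0 * p + a)
    refine h3.deriv.trans ?_
    simp only [involution_self, comp_apply, zero_mul, add_zero, ← sq]
    field_simp
  rw [hrep, hderiv, norm_div, norm_neg, hnorm, div_le_iff₀ hpos]
  refine hΓ0.trans (hG0.trans (le_of_eq ?_))
  field_simp

end Laurent

/-! ### A represented function that violates the bound -/

section Extremal

variable {p : ℝ}

/-- The represented function with `ω z = -z`. -/
def counterexample (hp : p ∈ Ioo (0 : ℝ) 1) : C(puncturedDisc p, ℂ) where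
  toFun z := ((z : ℂ) - p / (1 + (p : ℂ) ^ 2) * (1 + -z) * (z : ℂ) ^ 2) /
    ((1 - (z : ℂ) / p) * (1 - z * p))
  continuous_toFun := Continuous.div (by fun_prop) (by fun_prop) fun z => denominator_ne_zero hp z.2

theorem counterexample_mem (hp : p ∈ Ioo (0 : ℝ) 1) : counterexample hp ∈ representedClass p :=
  ⟨fun z => -z, differentiableOn_id.neg, fun z hz => by
    simpa using (show ‖z‖ < 1 by simpa using hz).le, fun _ => rfl⟩

theorem laurentCoeff_counterexample (hp : p ∈ Ioo (0 : ℝ) 1) :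
    laurentCoeff (counterexample hp) =
      ((p / (1 + p ^ 2) - p * (1 + p ^ 3) / ((1 + p ^ 2) * (1 - p ^ 2) ^ 3) : ℝ) : ℂ) := by
  have hp0 := ofReal_pole_ne_zero hp
  have hp2 := one_sub_sq_ne_zero hp
  have hp3 := one_add_sq_ne_zero (p := p)
  set κ : ℂ := p / (1 + p ^ 2) with hκ
  -- Partial fractions: `α` and `β` come from the poles at `p` and `1 / p`, and the constant `α / p
  -- - β` makes the value at `0` vanish.
  set β : ℂ := -(p ^ 3 + 1) / ((1 + p ^ 2) * (1 - p ^ 2)) with hβ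
  set α : ℂ := -p * (p - κ * p ^ 2 + κ * p ^ 3) / (1 - p ^ 2) with hα
  have hd : ∀ z : ℂ, ‖z‖ < 1 → HasDerivAt (fun z : ℂ => κ * z + (α / p - β) + β / (1 - p * z))
      (κ + β * p / (1 - p * z) ^ 2) z := by
    intro z hz
    have h1 := one_sub_mul_ne_zero hp hz
    have h2 := (((hasDerivAt_id z).const_mul κ).add_const (α / p - β)).add
      ((((hasDerivAt_id z).const_mul (p : ℂ)).const_sub 1).fun_inv h1 |>.const_mul β)
    refine (h2.congr_deriv ?_).congr_of_eventuallyEq (Eventually.of_forall fun w => ?_)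
    · simp only [id]
      ring
    · simp [div_eq_mul_inv]
  rw [laurentCoeff_eq_deriv hp (α := α) (fun z hz => (hd z (by simpa using
    hz)).differentiableAt.differentiableWithinAt) ?_, (hd p (norm_pole_lt_one hp)).deriv]
  · push_cast
    rw [hκ, hβ]
    field_simp
    ring
  · rintro ⟨z, hz⟩
    have hz1 : ‖z‖ < 1 := by simpa using hz.1
    have hzp : (z - p : ℂ) ≠ 0 := sub_ne_zero.2 hz.2
    have hzp' : (p - z : ℂ) ≠ 0 := sub_ne_zero.2 (Ne.symm hz.2)
    have h1 := one_sub_mul_ne_zero hp hz1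
    change (z - p / (1 + (p : ℂ) ^ 2) * (1 + -z) * z ^ 2) / ((1 - z / p) * (1 - z * p)) =
      α / (z - p) + (κ * z + (α / p - β) + β / (1 - p * z))
    have e : (1 - z / p : ℂ) = -(z - p) / p := by
      field_simp
      ring
    have e2 : (1 - z * p : ℂ) = 1 - p * z := by ring
    have h1' : (1 - z * p : ℂ) ≠ 0 := by rwa [e2]
    rw [e, ← e2, hα, hβ, hκ]
    field_simp
    ring

/-- The sign of the difference is that of `1 - 2p - 2p² + p³ + p⁴`; here `1 - 2p < 0` by `p > 1/2`,
and `p³ + p⁴ ≤ 2p²`. -/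
theorem laurentCoeff_counterexample_lt {p : ℝ} (hp : p ∈ Ioo (1 / 2 : ℝ) 1) :
    p / (1 + p ^ 2) - p * (1 + p ^ 3) / ((1 + p ^ 2) * (1 - p ^ 2) ^ 3) <
      -(p ^ 2 / (1 - p ^ 2) ^ 3) := by
  obtain ⟨hp1, hp2⟩ := hp
  have hp0 : 0 < p := by linarith
  have hpos : 0 < 1 - p ^ 2 := by nlinarith
  have h1 : p / (1 + p ^ 2) - p * (1 + p ^ 3) / ((1 + p ^ 2) * (1 - p ^ 2) ^ 3) +
      p ^ 2 / (1 - p ^ 2) ^ 3 = p ^ 2 * (1 - p) * (1 - 2 * p - 2 * p ^ 2 + p ^ 3 + p ^ 4) /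
        ((1 + p ^ 2) * (1 - p ^ 2) ^ 3) := by
    field_simp
    ring
  have h2 : 1 - 2 * p - 2 * p ^ 2 + p ^ 3 + p ^ 4 < 0 := by
    have h3 : p ^ 3 ≤ p ^ 2 := pow_le_pow_of_le_one hp0.le hp2.le (by norm_num)
    have h4 : p ^ 4 ≤ p ^ 2 := pow_le_pow_of_le_one hp0.le hp2.le (by norm_num)
    linarith
  have h5 : p ^ 2 * (1 - p) * (1 - 2 * p - 2 * p ^ 2 + p ^ 3 + p ^ 4) /
      ((1 + p ^ 2) * (1 - p ^ 2) ^ 3) < 0 := by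
    refine div_neg_of_neg_of_pos (mul_neg_of_pos_of_neg ?_ h2) (by positivity)
    have : 0 < 1 - p := by linarith
    positivity
  linarith

theorem closedConvexHull_Co_ssubset {p : ℝ} (hp : p ∈ Ioo (1 / 2 : ℝ) 1) :
    closedConvexHull ℝ (Co p) ⊂ representedClass p := by
  have hp' : p ∈ Ioo (0 : ℝ) 1 := ⟨by linarith [hp.1], hp.2⟩
  refine (ssubset_iff_of_subset (closedConvexHull_min (Co_subset_representedClass hp')
    convex_representedClass (isClosed_representedClass hp'))).2
    ⟨counterexample hp', counterexample_mem hp', fun hmem => ?_⟩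
  have hsub : closedConvexHull ℝ (Co p) ⊆
      {f | -(p ^ 2 / (1 - p ^ 2) ^ 3) ≤ (laurentCoeff f).re} := by
    refine closedConvexHull_min (fun f hf => ?_) ?_ ?_
    · have h1 := norm_laurentCoeff_le hp' hf
      exact (abs_le.1 ((Complex.abs_re_le_norm _).trans h1)).1
    · intro f hf g hg a b ha hb hab
      simp only [mem_ofPred_eq] at hf hg ⊢
      rw [laurentCoeff_combination hp']
      simp only [Complex.add_re, Complex.real_smul, Complex.re_ofReal_mul]
      calc -(p ^ 2 / (1 - p ^ 2) ^ 3)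
          = a * -(p ^ 2 / (1 - p ^ 2) ^ 3) + b * -(p ^ 2 / (1 - p ^ 2) ^ 3) := by
            rw [← add_mul, hab, one_mul]
        _ ≤ _ := by gcongr
    · exact isClosed_le continuous_const
        (Complex.continuous_re.comp (continuous_laurentCoeff hp'))
  have h2 := hsub hmem
  rw [mem_ofPred_eq, laurentCoeff_counterexample, Complex.ofReal_re] at h2
  exact absurd h2 (not_le.2 (laurentCoeff_counterexample_lt hp))

end Extremal

end ConcaveUnivalent

end

theorem theorem3 (p : ℝ) (hp : p ∈ Set.Ioo (√3 - 1) 1) :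
    closedConvexHull ℝ (ConcaveUnivalent.Co p) ⊂ ConcaveUnivalent.representedClass p := by
  -- This gives `p > √3 - 1 > 1/2`.
  have h : (3 / 2 : ℝ) < √3 := Real.lt_sqrt_of_sq_lt (by norm_num)
  exact ConcaveUnivalent.closedConvexHull_Co_ssubset ⟨by linarith [hp.1], hp.2⟩
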